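/- Let $\beta\in(1,2)$ and $\tau\in(0,\tfrac12)$, let $f:[0,1]^2\to[0,1]^2$ be given by $f(x,y)=(\beta x,\tau y)$ for $x\in[0,\beta^{-1}]$ and $f(x,y)=(\beta x-1,\tau y+(1-\tau))$ for $x\in(\beta^{-1},1]$, and let $\Lambda_{\beta,\tau}$ be the closure of $\bigcap_{i\ge0}f^i([0,1]^2)$. Let $\overline X_\beta$ be the two-sided $\beta$-shift, that is, the closure in $\{0,1\}^{\mathbb Z}$ of $X_\beta=\{(s_k):\sum_{k\ge1}s_{i-k}\beta^{-k}<1\text{ for all }i\in\mathbb Z\}$, with the shift $\sigma((s_k))=(s_{k-1})$, and let $\pi((s_k))=\bigl(\sum_{k\ge1}s_{-k}\beta^{-k},\ \sum_{k\ge0}s_k(1-\tau)\tau^k\bigr)$. Let $\mu_\beta$ be the Parry measure of $(\overline X_\beta,\sigma)$, that is, the $\sigma$-invariant probability measure for which $(s_{-1},s_{-2},\dots)$ is distributed as the greedy $\beta$-expansion of a point of $[0,1)$ chosen with the density proportional to $x\mapsto\sum_{n\ge0,\ x<T^n1}\beta^{-n}$, where $Tx=\beta x \bmod 1$ and $T^01=1$.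 Then $f(\Lambda_{\beta,\tau})\subseteq\Lambda_{\beta,\tau}$, and the system $(\Lambda_{\beta,\tau},f)$ has topological entropy (defined by open covers) equal to $\log\beta$. Moreover $\mu_\beta$ exists and is $\sigma$-ergodic with metric entropy $\log\beta$, and its projection $\nu_\beta=\mu_\beta\circ\pi^{-1}$ is a Borel probability measure on $\Lambda_{\beta,\tau}$ that is $f$-ergodic and has full entropy, $h(f|_{\Lambda_{\beta,\tau}},\nu_\beta)=\log\beta=h(f|_{\Lambda_{\beta,\tau}})$. -/

import Mathlib

open Set Filter Topology MeasureTheory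

namespace BetaAttractor

noncomputable section

/-! ### Topological entropy through open covers -/

section TopologicalEntropy

variable {X : Type*}

/-- The minimal number of elements of the family `U` that cover `X`. (Every family to which this is
applied below has a finite subfamily covering the space, since the space is compact.) -/
def coverNumber (U : Set (Set X)) : ℕ :=
  sInf {n : ℕ | ∃ F : Finset (Set X), (F : Set (Set X)) ⊆ U ∧ ⋃₀ (F : Set (Set X)) = univ ∧
    F.card = n}

/-- The common refinement `U ∨ T⁻¹ U ∨ ⋯ ∨ T⁻ⁿ U`. -/
def coverJoin (T : X → X) (U : Set (Set X)) (n : ℕ) : Set (Set X) :=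
  {W | ∃ c : Fin (n + 1) → Set X, (∀ i, c i ∈ U) ∧ W = ⋂ i : Fin (n + 1), T^[(i : ℕ)] ⁻¹' (c i)}

/-- The entropy `lim (1/n) log N(U ∨ T⁻¹ U ∨ ⋯ ∨ T⁻ⁿ U)` of `T` with respect to the cover `U`.
The limit exists by subadditivity and is written as a `limsup`. -/
def coverEntropyWrt (T : X → X) (U : Set (Set X)) : EReal :=
  limsup (fun n : ℕ => ((Real.log (coverNumber (coverJoin T U n)) / n : ℝ) : EReal)) atTop

/-- Topological entropy of a (not necessarily continuous) self-map of a compact space. -/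
def topologicalEntropy [TopologicalSpace X] (T : X → X) : EReal :=
  ⨆ (U : Set (Set X)) (_ : (∀ u ∈ U, IsOpen u) ∧ ⋃₀ U = univ), coverEntropyWrt T U

end TopologicalEntropy

/-! ### Metric entropy -/

section MetricEntropy

variable {X : Type*} [MeasurableSpace X]

/-- The entropy `- ∑ μ(P) log μ(P)` of the finite partition of `X` into the fibres of `p`. -/
def partitionEntropy {ι : Type*} [Fintype ι] (μ : Measure X) (p : X → ι) : ℝ :=
  ∑ a, Real.negMulLog (μ.real (p ⁻¹' {a}))

/-- The labelling whose fibres are the cells of `P ∨ T⁻¹ P ∨ ⋯ ∨ T⁻ⁿ P`, where `P` is the partition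
into the fibres of `p`. -/
def itinerary {ι : Type*} (T : X → X) (p : X → ι) (n : ℕ) : X → (Fin (n + 1) → ι) :=
  fun x i => p (T^[(i : ℕ)] x)

/-- The entropy `lim (1/n) H(μ, P ∨ T⁻¹ P ∨ ⋯ ∨ T⁻ⁿ P)`. The limit exists by subadditivity when
`T` preserves `μ`, and is written as a `limsup`. -/
def metricEntropyWrt {ι : Type*} [Fintype ι] (T : X → X) (μ : Measure X) (p : X → ι) : EReal :=
  limsup (fun n : ℕ => ((partitionEntropy μ (itinerary T p n) / n : ℝ) : EReal)) atTop

/-- Metric (Kolmogorov–Sinai) entropy: the supremum over all finite measurable partitions. -/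
def metricEntropy (T : X → X) (μ : Measure X) : EReal :=
  ⨆ (k : ℕ) (p : X → Fin k) (_ : Measurable p), metricEntropyWrt T μ p

end MetricEntropy

/-! ### The attractor -/

/-- The map `f`; only its values on the unit square matter, which it maps to itself. -/
def bakerMap (β τ : ℝ) (p : ℝ × ℝ) : ℝ × ℝ :=
  if p.1 ≤ β⁻¹ then (β * p.1, τ * p.2) else (β * p.1 - 1, τ * p.2 + (1 - τ))

/-- The attractor `Λ`, the closure of `⋂ fⁱ([0,1]²)`. -/
def attractor (β τ : ℝ) : Set (ℝ × ℝ) :=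
  closure (⋂ i : ℕ, (bakerMap β τ)^[i] '' (Icc (0 : ℝ) 1 ×ˢ Icc (0 : ℝ) 1))

/-! ### The two-sided β-shift -/

/-- The shift `(s_k) ↦ (s_{k-1})` on bi-infinite sequences. -/
def shift (s : ℤ → Fin 2) : ℤ → Fin 2 := fun k => s (k - 1)

/-- The set `X_β` of sequences with `∑_{k ≥ 1} s_{i-k} β^{-k} < 1` for all `i`. -/
def preBetaShift (β : ℝ) : Set (ℤ → Fin 2) :=
  {s | ∀ i : ℤ, ∑' k : ℕ, ((s (i - (k + 1)) : ℕ) : ℝ) * β⁻¹ ^ (k + 1) < 1}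

/-- The two-sided β-shift, the closure of `X_β`. -/
def betaShift (β : ℝ) : Set (ℤ → Fin 2) := closure (preBetaShift β)

theorem continuous_shift : Continuous shift :=
  continuous_pi fun k => continuous_apply (k - 1)

theorem mapsTo_shift_preBetaShift (β : ℝ) :
    MapsTo shift (preBetaShift β) (preBetaShift β) := by
  intro s hs i
  have h := hs (i - 1)
  have e : ∀ k : ℕ, i - 1 - ((k : ℤ) + 1) = i - ((k : ℤ) + 1) - 1 := fun k => by ring
  simpa only [shift, e] using h

theorem mapsTo_shift_betaShift (β : ℝ) : MapsTo shift (betaShift β) (betaShift β) :=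
  (mapsTo_shift_preBetaShift β).closure continuous_shift

/-- The shift on the two-sided β-shift. -/
def betaShiftMap (β : ℝ) : betaShift β → betaShift β :=
  (mapsTo_shift_betaShift β).restrict shift (betaShift β) (betaShift β)

/-- The coding map `π(s) = (∑_{k ≥ 1} s_{-k} β^{-k}, ∑_{k ≥ 0} s_k (1 - τ) τ^k)`. -/
def coding (β τ : ℝ) (s : ℤ → Fin 2) : ℝ × ℝ :=
  (∑' k : ℕ, ((s (-((k : ℤ) + 1)) : ℕ) : ℝ) * β⁻¹ ^ (k + 1),
    ∑' k : ℕ, ((s (k : ℤ) : ℕ) : ℝ) * (1 - τ) * τ ^ k)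

/-! ### The Parry measure -/

/-- The β-transformation `x ↦ β x mod 1`. -/
def betaMap (β x : ℝ) : ℝ := Int.fract (β * x)

/-- The digits `⌊β T^k x⌋`, `k ≥ 0`, of the greedy β-expansion of `x ∈ [0,1)`, for `1 < β < 2`. -/
def betaDigits (β x : ℝ) : ℕ → Fin 2 := fun k => if 1 ≤ β * (betaMap β)^[k] x then 1 else 0

/-- The measure on `[0,1)` with Parry's density `x ↦ ∑_{n ≥ 0, x < T^n 1} β^{-n}`,
before normalization. -/
def parryUnnormalized (β : ℝ) : Measure ℝ :=
  (volume.restrict (Ico (0 : ℝ) 1)).withDensity fun x =>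
    ∑' n : ℕ, if x < (betaMap β)^[n] 1 then ENNReal.ofReal (β⁻¹ ^ n) else 0

/-- Parry's invariant probability measure of the β-transformation on `[0,1)`. -/
def parryInterval (β : ℝ) : Measure ℝ :=
  (parryUnnormalized β univ)⁻¹ • parryUnnormalized β

/-- `μ` is the Parry measure of the two-sided β-shift: it is shift invariant, and the one-sided
sequence `(s_{-1}, s_{-2}, …)` is distributed as the greedy β-expansion of a point of `[0,1)` chosen
with Parry's invariant distribution. By invariance this prescribes the measure of every cylinder, so
there is at most one such measure. -/
structure IsParryMeasure (β : ℝ) (μ : Measure (betaShift β)) : Prop where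
  invariant : MeasurePreserving (betaShiftMap β) μ μ
  marginal : μ.map (fun s (k : ℕ) => s.1 (-((k : ℤ) + 1))) = (parryInterval β).map (betaDigits β)

end

end BetaAttractor

/-!
The digits of a point of the two-sided shift to the past of an index form a greedy `β`-expansion,
so the Parry measure is the natural extension of the `β`-transformation with its absolutely
continuous invariant measure. That measure is comparable with Lebesgue measure, and expansion
eventually spreads every cylinder over all of `[0, 1)` with bounded distortion of proportions,
which forces ergodicity. There are at most `C * β ^ n` admissible words of length `n`, and a
cylinder of length `n` has measure at most `C * β⁻¹ ^ n`, which pins the metric entropy to `log β`.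

The coding map intertwines the shift with the baker map except over the abscissa `β⁻¹`, which is a
null set. Ergodicity and the upper bound for the entropy therefore descend to the attractor, and
the first digit is still read off from the abscissa, so no entropy is lost.

For the topological entropy, an orbit of length `n` is determined up to small error by a word and a
vertical position; conversely each iteration stretches horizontal segments by `β`, so `β ^ n` cells
up to a constant are needed to cover the bottom edge.
-/

namespace BetaAttractor

noncomputable section

/-! ### Entropy of finite partitions -/

section PartitionEntropy

variable {X : Type*} [MeasurableSpace X] {μ : Measure X}
  {ι κ : Type*} [Fintype ι] [MeasurableSpace ι] [MeasurableSingletonClass ι]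
  [Fintype κ] [MeasurableSpace κ] [MeasurableSingletonClass κ]

theorem measurable_itinerary {α : Type*} [MeasurableSpace α] {T : X → X} (hT : Measurable T)
    {p : X → α} (hp : Measurable p) (n : ℕ) : Measurable (itinerary T p n) :=
  measurable_pi_lambda _ fun i => hp.comp (hT.iterate i)

omit [MeasurableSpace ι] [MeasurableSingletonClass ι] in
theorem partitionEntropy_congr {p q : X → ι} (h : p =ᵐ[μ] q) :
    partitionEntropy μ p = partitionEntropy μ q := by
  refine Finset.sum_congr rfl fun a _ => congrArg Real.negMulLog (measureReal_congr ?_)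
  filter_upwards [h] with x hx
  exact congrArg (· = a) hx

theorem partitionEntropy_comp_measurePreserving {Y : Type*} [MeasurableSpace Y] {ν : Measure Y}
    {g : X → Y} (hg : MeasurePreserving g μ ν) {p : Y → ι} (hp : Measurable p) :
    partitionEntropy μ (p ∘ g) = partitionEntropy ν p := by
  refine Finset.sum_congr rfl fun a _ => ?_
  rw [preimage_comp, hg.measureReal_preimage (hp (measurableSet_singleton a)).nullMeasurableSet]

section FiniteMeasure

variable [IsFiniteMeasure μ]

omit [Fintype ι] in
theorem integrable_comp_of_finite [Finite ι] {p : X → ι} (hp : Measurable p) (w : ι → ℝ) :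
    Integrable (fun x => w (p x)) μ :=
  Integrable.of_finite.comp_measurable hp

theorem integral_comp_eq_sum {p : X → ι} (hp : Measurable p) (w : ι → ℝ) :
    ∫ x, w (p x) ∂μ = ∑ a, μ.real (p ⁻¹' {a}) * w a := by
  rw [← integral_map hp.aemeasurable (by fun_prop), integral_fintype Integrable.of_finite]
  simp only [map_measureReal_apply hp (measurableSet_singleton _), smul_eq_mul]

theorem partitionEntropy_eq_integral {p : X → ι} (hp : Measurable p) :
    partitionEntropy μ p = ∫ x, -Real.log (μ.real (p ⁻¹' {p x})) ∂μ := by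
  rw [integral_comp_eq_sum hp fun a => -Real.log (μ.real (p ⁻¹' {a}))]
  exact Finset.sum_congr rfl fun a _ => neg_mul_comm _ _

omit [Fintype ι] [MeasurableSpace ι] [MeasurableSingletonClass ι] in
theorem ae_measureReal_preimage_pos [Finite ι] (p : X → ι) : ∀ᵐ x ∂μ, 0 < μ.real (p ⁻¹' {p x}) := by
  have h : ∀ a, ∀ᵐ x ∂μ, p x = a → 0 < μ.real (p ⁻¹' {a}) := by
    intro a
    rcases measureReal_nonneg.eq_or_lt with h0 | h0
    · have hnull : μ (p ⁻¹' {a}) = 0 := (measureReal_eq_zero_iff (by finiteness)).1 h0.symm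
      filter_upwards [measure_eq_zero_iff_ae_notMem.1 hnull] with x hx hxa
      exact absurd hxa hx
    · exact .of_forall fun _ _ => h0
  filter_upwards [ae_all_iff.2 h] with x hx
  exact hx _ rfl

theorem partitionEntropy_comp_le {p : X → ι} (hp : Measurable p) (g : ι → κ) :
    partitionEntropy μ (g ∘ p) ≤ partitionEntropy μ p := by
  have hg : Measurable (g ∘ p) := (measurable_of_finite g).comp hp
  rw [partitionEntropy_eq_integral hp, partitionEntropy_eq_integral hg]
  refine integral_mono_ae (integrable_comp_of_finite hg fun b => -Real.log (μ.real (_ ⁻¹' {b})))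
    (integrable_comp_of_finite hp fun a => -Real.log (μ.real (p ⁻¹' {a}))) ?_
  filter_upwards [ae_measureReal_preimage_pos p] with x hx
  refine neg_le_neg (Real.log_le_log hx (measureReal_mono ?_))
  exact fun y (hy : p y = p x) => congrArg g hy

end FiniteMeasure

section ProbabilityMeasure

variable [IsProbabilityMeasure μ]

theorem neg_log_le_partitionEntropy {p : X → ι} (hp : Measurable p) {b : ℝ}
    (hb : ∀ a, μ.real (p ⁻¹' {a}) ≤ b) : -Real.log b ≤ partitionEntropy μ p := by
  have hconst : -Real.log b = ∫ _, -Real.log b ∂μ := by simp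
  rw [partitionEntropy_eq_integral hp, hconst]
  refine integral_mono_ae (integrable_const _)
    (integrable_comp_of_finite hp fun a => -Real.log (μ.real (p ⁻¹' {a}))) ?_
  filter_upwards [ae_measureReal_preimage_pos p] with x hx
  exact neg_le_neg (Real.log_le_log hx (hb _))

theorem partitionEntropy_le_integral_neg_log {p : X → ι} (hp : Measurable p) {q : ι → ℝ}
    (hq : ∀ a, 0 ≤ q a) (hqs : ∑ a, q a ≤ 1) (hpq : ∀ᵐ x ∂μ, q (p x) ≠ 0) :
    partitionEntropy μ p ≤ ∫ x, -Real.log (q (p x)) ∂μ := by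
  let r : ι → ℝ := fun a => q a / μ.real (p ⁻¹' {a})
  have hr : ∫ x, r (p x) ∂μ ≤ 1 := by
    rw [integral_comp_eq_sum hp]
    refine (Finset.sum_le_sum fun a _ => ?_).trans hqs
    rcases eq_or_ne (μ.real (p ⁻¹' {a})) 0 with h0 | h0
    · simpa [r, h0] using hq a
    · exact (mul_div_cancel₀ _ h0).le
  have hle : ∫ x, -Real.log (μ.real (p ⁻¹' {p x})) ∂μ ≤
      ∫ x, (-Real.log (q (p x)) + (r (p x) - 1)) ∂μ := by
    refine integral_mono_ae
      (integrable_comp_of_finite hp fun a => -Real.log (μ.real (p ⁻¹' {a})))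
      (integrable_comp_of_finite hp fun a => -Real.log (q a) + (r a - 1)) ?_
    filter_upwards [hpq, ae_measureReal_preimage_pos p] with x hqx hx
    have hqx' : 0 < q (p x) := (hq _).lt_of_ne' hqx
    have hlog := Real.log_le_sub_one_of_pos (div_pos hqx' hx)
    rw [Real.log_div hqx hx.ne'] at hlog
    simp only [r]
    linarith
  rw [partitionEntropy_eq_integral hp]
  refine hle.trans ?_
  rw [integral_add (integrable_comp_of_finite hp fun a => -Real.log (q a))
      (integrable_comp_of_finite hp fun a => r a - 1),
    integral_sub (integrable_comp_of_finite hp r) (integrable_const _), integral_const,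
    probReal_univ, one_smul]
  linarith

theorem partitionEntropy_le_log_card {p : X → ι} (hp : Measurable p) (F : Finset ι)
    (hF : ∀ᵐ x ∂μ, p x ∈ F) : partitionEntropy μ p ≤ Real.log F.card := by
  classical
  obtain ⟨x₀, hx₀⟩ := hF.exists
  have hcard : (F.card : ℝ) ≠ 0 := by exact_mod_cast (Finset.card_pos.2 ⟨_, hx₀⟩).ne'
  let q : ι → ℝ := fun a => if a ∈ F then (F.card : ℝ)⁻¹ else 0
  have hqs : ∑ a, q a = 1 := by simp [q, hcard]
  have hqF : ∀ᵐ x ∂μ, q (p x) = (F.card : ℝ)⁻¹ := hF.mono fun x hx => if_pos hx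
  calc partitionEntropy μ p ≤ ∫ x, -Real.log (q (p x)) ∂μ :=
        partitionEntropy_le_integral_neg_log hp (fun a => by positivity) hqs.le
          (hqF.mono fun x hx => by simpa [hx] using hcard)
    _ = ∫ _, Real.log F.card ∂μ :=
        integral_congr_ae (hqF.mono fun x hx => by simp [hx])
    _ = Real.log F.card := by simp

theorem sum_measureReal_preimage_singleton {p : X → ι} (hp : Measurable p) :
    ∑ a, μ.real (p ⁻¹' {a}) = 1 := by
  simpa using (integral_comp_eq_sum (μ := μ) hp fun _ => 1).symm

theorem partitionEntropy_prod_le {p : X → ι} {q : X → κ} (hp : Measurable p) (hq : Measurable q) :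
    partitionEntropy μ (fun x => (p x, q x)) ≤ partitionEntropy μ p + partitionEntropy μ q := by
  have hpos : ∀ᵐ x ∂μ, 0 < μ.real (p ⁻¹' {p x}) ∧ 0 < μ.real (q ⁻¹' {q x}) :=
    (ae_measureReal_preimage_pos p).and (ae_measureReal_preimage_pos q)
  have hsum : ∑ c : ι × κ, μ.real (p ⁻¹' {c.1}) * μ.real (q ⁻¹' {c.2}) = 1 := by
    simp only [Fintype.sum_prod_type]
    rw [← Fintype.sum_mul_sum, sum_measureReal_preimage_singleton hp,
      sum_measureReal_preimage_singleton hq, one_mul]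
  calc partitionEntropy μ (fun x => (p x, q x))
      ≤ ∫ x, -Real.log (μ.real (p ⁻¹' {p x}) * μ.real (q ⁻¹' {q x})) ∂μ :=
        partitionEntropy_le_integral_neg_log (hp.prodMk hq)
          (q := fun c => μ.real (p ⁻¹' {c.1}) * μ.real (q ⁻¹' {c.2}))
          (fun c => by positivity) hsum.le (hpos.mono fun x hx => (mul_pos hx.1 hx.2).ne')
    _ = ∫ x, (-Real.log (μ.real (p ⁻¹' {p x})) + -Real.log (μ.real (q ⁻¹' {q x}))) ∂μ :=
        integral_congr_ae <| hpos.mono fun x hx => by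
          simp only [Real.log_mul hx.1.ne' hx.2.ne', neg_add]
    _ = partitionEntropy μ p + partitionEntropy μ q := by
        rw [partitionEntropy_eq_integral hp, partitionEntropy_eq_integral hq,
          integral_add (integrable_comp_of_finite hp fun a => -Real.log (μ.real (p ⁻¹' {a})))
            (integrable_comp_of_finite hq fun b => -Real.log (μ.real (q ⁻¹' {b})))]

end ProbabilityMeasure

/-! ### Entropy of itineraries -/

variable [IsProbabilityMeasure μ] {T : X → X}

theorem partitionEntropy_itinerary_le (hT : MeasurePreserving T μ μ) {p : X → ι}
    (hp : Measurable p) (n : ℕ) :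
    partitionEntropy μ (itinerary T p n) ≤ (n + 1) * partitionEntropy μ p := by
  induction n with
  | zero =>
    have hcomp : itinerary T p 0 = (fun a (_ : Fin 1) => a) ∘ p := by
      funext x i
      simp [itinerary]
    rw [hcomp]
    simpa using partitionEntropy_comp_le hp _
  | succ n ih =>
    have hsnoc : itinerary T p (n + 1) =
        (fun c : (Fin (n + 1) → ι) × ι => (Fin.snoc c.1 c.2 : Fin (n + 2) → ι)) ∘
          (fun x => (itinerary T p n x, (p ∘ T^[n + 1]) x)) := by
      funext x i
      refine Fin.lastCases ?_ (fun j => ?_) i <;> simp [itinerary]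
    have hlast : Measurable (p ∘ T^[n + 1]) := hp.comp (hT.measurable.iterate _)
    have hinit := measurable_itinerary hT.measurable hp n
    calc partitionEntropy μ (itinerary T p (n + 1))
        ≤ partitionEntropy μ (fun x => (itinerary T p n x, (p ∘ T^[n + 1]) x)) := by
          rw [hsnoc]
          exact partitionEntropy_comp_le (hinit.prodMk hlast) _
      _ ≤ partitionEntropy μ (itinerary T p n) + partitionEntropy μ (p ∘ T^[n + 1]) :=
          partitionEntropy_prod_le hinit hlast
      _ ≤ ((n + 1 : ℕ) + 1) * partitionEntropy μ p := by
          rw [partitionEntropy_comp_measurePreserving (hT.iterate (n + 1)) hp]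
          push_cast
          linarith

open Classical in
/-- The symbol by which `p` differs from `q`, or `()` where they agree. It is the information that
has to be added to `q` in order to recover `p`. -/
def discrepancy {α : Type*} (p q : X → α) (x : X) : Unit ⊕ α :=
  if p x = q x then .inl () else .inr (p x)

instance {α β : Type*} [MeasurableSpace α] [MeasurableSingletonClass α] [MeasurableSpace β]
    [MeasurableSingletonClass β] : MeasurableSingletonClass (α ⊕ β) where
  measurableSet_singleton c := by
    rcases c with a | b
    · simpa using (measurableSet_singleton a).inl_image (β := β)
    · simpa using (measurableSet_singleton b).inr_image (α := α)

omit [Fintype ι] in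
theorem measurable_discrepancy [Finite ι] {p q : X → ι} (hp : Measurable p) (hq : Measurable q) :
    Measurable (discrepancy p q) :=
  Measurable.ite (measurableSet_eq_fun hp hq) measurable_const (measurable_inr.comp hp)

theorem partitionEntropy_itinerary_le_add (hT : MeasurePreserving T μ μ) {p q : X → ι}
    (hp : Measurable p) (hq : Measurable q) (n : ℕ) :
    partitionEntropy μ (itinerary T p n) ≤
      partitionEntropy μ (itinerary T q n) + (n + 1) * partitionEntropy μ (discrepancy p q) := by
  have hd := measurable_discrepancy hp hq
  have hcorrect : itinerary T p n = (fun c : (Fin (n + 1) → ι) × (Fin (n + 1) → Unit ⊕ ι) =>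
      fun i => (c.2 i).elim (fun _ => c.1 i) id) ∘
      (fun x => (itinerary T q n x, itinerary T (discrepancy p q) n x)) := by
    funext x i
    simp only [itinerary, discrepancy, Function.comp]
    split_ifs with h <;> simp [h]
  have hqn := measurable_itinerary hT.measurable hq n
  have hdn := measurable_itinerary hT.measurable hd n
  calc partitionEntropy μ (itinerary T p n)
      ≤ partitionEntropy μ (fun x => (itinerary T q n x, itinerary T (discrepancy p q) n x)) := by
        rw [hcorrect]
        exact partitionEntropy_comp_le (hqn.prodMk hdn) _
    _ ≤ partitionEntropy μ (itinerary T q n) +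
        partitionEntropy μ (itinerary T (discrepancy p q) n) := partitionEntropy_prod_le hqn hdn
    _ ≤ _ := by grw [partitionEntropy_itinerary_le hT hd n]

variable (ι) in
theorem exists_partitionEntropy_discrepancy_le (μ : Measure X) [IsProbabilityMeasure μ] {ε : ℝ}
    (hε : 0 < ε) : ∃ δ > 0, ∀ p q : X → ι, Measurable p → Measurable q →
      μ.real {x | p x ≠ q x} ≤ δ → partitionEntropy μ (discrepancy p q) ≤ ε := by
  set ε' := ε / Fintype.card (Unit ⊕ ι) with hε'
  have hε'0 : 0 < ε' := by positivity
  obtain ⟨δ, hδ, hsmall⟩ := Metric.eventually_nhds_iff.1 <|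
    (Real.continuous_negMulLog.tendsto 0).eventually_lt (tendsto_const_nhds (x := ε')) (by simpa)
  refine ⟨min (δ / 2) ε', by positivity, fun p q hp hq h => ?_⟩
  have hcell : ∀ c, Real.negMulLog (μ.real (discrepancy p q ⁻¹' {c})) ≤ ε' := by
    rintro (_ | a)
    · have hagree : {x | p x ≠ q x} = (discrepancy p q ⁻¹' {.inl ()})ᶜ := by
        ext x
        simp [discrepancy]
      rw [hagree, probReal_compl_eq_one_sub
        (measurable_discrepancy hp hq (measurableSet_singleton _))] at h
      exact (Real.negMulLog_le_one_sub_self measureReal_nonneg).trans (h.trans (min_le_right _ _))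
    · have hle : μ.real (discrepancy p q ⁻¹' {.inr a}) ≤ μ.real {x | p x ≠ q x} :=
        measureReal_mono fun x hx hxx => by simp [discrepancy, hxx] at hx
      refine (hsmall ?_).le
      rw [Real.dist_eq, sub_zero, abs_of_nonneg measureReal_nonneg]
      linarith [hle.trans (h.trans (min_le_left _ _))]
  calc partitionEntropy μ (discrepancy p q) ≤ ∑ _ : Unit ⊕ ι, ε' :=
        Finset.sum_le_sum fun c _ => hcell c
    _ = ε := by
        rw [Finset.sum_const, nsmul_eq_mul, Finset.card_univ, hε', mul_div_cancel₀]
        positivity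

end PartitionEntropy

/-! ### Growth rates -/

section GrowthRate

theorem tendsto_coe_affine_div (L C : ℝ) :
    Tendsto (fun n : ℕ => (((n * L + C) / n : ℝ) : EReal)) atTop (𝓝 (L : EReal)) := by
  refine (continuous_coe_real_ereal.tendsto L).comp ?_
  have h : Tendsto (fun n : ℕ => L + C / n) atTop (𝓝 L) := by
    simpa using tendsto_const_nhds.add (tendsto_const_div_atTop_nhds_zero_nat C)
  refine h.congr' ?_
  filter_upwards [eventually_ne_atTop 0] with n hn
  field_simp

variable {u : ℕ → ℝ} {L C : ℝ}

theorem limsup_div_le (h : ∀ n, u n ≤ n * L + C) :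
    limsup (fun n : ℕ => ((u n / n : ℝ) : EReal)) atTop ≤ L := by
  rw [← (tendsto_coe_affine_div L C).limsup_eq]
  refine limsup_le_limsup (Eventually.of_forall fun n => ?_)
  exact EReal.coe_le_coe_iff.2 (div_le_div_of_nonneg_right (h n) n.cast_nonneg)

theorem le_limsup_div (h : ∀ n, n * L + C ≤ u n) :
    (L : EReal) ≤ limsup (fun n : ℕ => ((u n / n : ℝ) : EReal)) atTop := by
  rw [← (tendsto_coe_affine_div L C).limsup_eq]
  refine limsup_le_limsup (Eventually.of_forall fun n => ?_)
  exact EReal.coe_le_coe_iff.2 (div_le_div_of_nonneg_right (h n) n.cast_nonneg)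

end GrowthRate

theorem metricEntropyWrt_le_of_approx {X : Type*} [MeasurableSpace X] {ι : Type*} [Fintype ι]
    [MeasurableSpace ι] [MeasurableSingletonClass ι] {μ : Measure X} [IsProbabilityMeasure μ]
    {T : X → X} (hT : MeasurePreserving T μ μ) {p : X → ι} (hp : Measurable p) {L : ℝ}
    (h : ∀ δ > 0, ∃ (q : X → ι) (C : ℝ), Measurable q ∧ μ.real {x | p x ≠ q x} ≤ δ ∧
      ∀ n : ℕ, partitionEntropy μ (itinerary T q n) ≤ n * L + C) :
    metricEntropyWrt T μ p ≤ L := by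
  refine EReal.le_of_forall_lt_iff_le.1 fun M hM => ?_
  have hLM : 0 < M - L := sub_pos.2 (EReal.coe_lt_coe_iff.1 hM)
  obtain ⟨δ, hδ, hdisc⟩ := exists_partitionEntropy_discrepancy_le ι μ hLM
  obtain ⟨q, C, hq, hpq, hC⟩ := h δ hδ
  refine limsup_div_le (C := C + (M - L)) fun n => ?_
  calc partitionEntropy μ (itinerary T p n)
      ≤ partitionEntropy μ (itinerary T q n) + (n + 1) * partitionEntropy μ (discrepancy p q) :=
        partitionEntropy_itinerary_le_add hT hp hq n
    _ ≤ (n * L + C) + (n + 1) * (M - L) := by grw [hC n, hdisc p q hp hq hpq]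
    _ = n * M + (C + (M - L)) := by ring

theorem metricEntropyWrt_le_metricEntropy {X : Type*} [MeasurableSpace X] {μ : Measure X}
    {T : X → X} {k : ℕ} {p : X → Fin k} (hp : Measurable p) :
    metricEntropyWrt T μ p ≤ metricEntropy T μ :=
  le_iSup_of_le k (le_iSup₂_of_le p hp le_rfl)

/-! ### The β-transformation -/

section BetaMap

variable {β : ℝ}

theorem measurable_betaMap (β : ℝ) : Measurable (betaMap β) :=
  measurable_fract.comp (measurable_const_mul β)

theorem measurable_betaDigits (β : ℝ) : Measurable (betaDigits β) :=
  measurable_pi_lambda _ fun k =>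
    Measurable.ite (measurableSet_le measurable_const
      (((measurable_betaMap β).iterate k).const_mul β)) measurable_const measurable_const

theorem betaDigits_iterate (β x : ℝ) (n k : ℕ) :
    betaDigits β ((betaMap β)^[n] x) k = betaDigits β x (n + k) := by
  simp only [betaDigits, ← Function.iterate_add_apply, add_comm]

theorem betaDigits_zero_eq_zero {x : ℝ} : betaDigits β x 0 = 0 ↔ β * x < 1 := by
  rw [betaDigits, Function.iterate_zero_apply]
  split_ifs with h <;> simpa using h

theorem betaDigits_zero_eq_one {x : ℝ} : betaDigits β x 0 = 1 ↔ 1 ≤ β * x := by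
  rw [betaDigits, Function.iterate_zero_apply]
  split_ifs with h <;> simp [h]

theorem betaMap_mem_Ico (β x : ℝ) : betaMap β x ∈ Ico (0 : ℝ) 1 :=
  ⟨Int.fract_nonneg _, Int.fract_lt_one _⟩

theorem iterate_betaMap_mem_Ico {x : ℝ} (hx : x ∈ Ico (0 : ℝ) 1) (n : ℕ) :
    (betaMap β)^[n] x ∈ Ico (0 : ℝ) 1 :=
  MapsTo.iterate (fun y _ => betaMap_mem_Ico β y) n hx

theorem iterate_betaMap_mem_Icc {x : ℝ} (hx : x ∈ Icc (0 : ℝ) 1) (n : ℕ) :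
    (betaMap β)^[n] x ∈ Icc (0 : ℝ) 1 :=
  MapsTo.iterate (fun y _ => Ico_subset_Icc_self (betaMap_mem_Ico β y)) n hx

theorem betaMap_eq_sub_digit (hβ0 : 0 ≤ β) (hβ2 : β < 2) {x : ℝ} (hx : x ∈ Icc (0 : ℝ) 1) :
    betaMap β x = β * x - (betaDigits β x 0 : ℕ) := by
  have hx0 : 0 ≤ β * x := mul_nonneg hβ0 hx.1
  have hx2 : β * x < 2 := by nlinarith [hx.1, hx.2]
  rcases lt_or_ge (β * x) 1 with h | h
  · rw [betaDigits_zero_eq_zero.2 h, Fin.val_zero, Nat.cast_zero, sub_zero]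
    exact Int.fract_eq_self.2 ⟨hx0, h⟩
  · rw [betaDigits_zero_eq_one.2 h, betaMap, ← Int.fract_sub_one]
    simpa using Int.fract_eq_self.2 (⟨by linarith, by linarith⟩ : β * x - 1 ∈ Ico (0 : ℝ) 1)

theorem betaDigits_zero_eq_iff (hβ0 : 0 ≤ β) (hβ2 : β < 2) {x : ℝ} (hx : x ∈ Icc (0 : ℝ) 1)
    {d : Fin 2} : betaDigits β x 0 = d ↔ β * x - (d : ℕ) ∈ Ico (0 : ℝ) 1 := by
  refine ⟨?_, fun h => ?_⟩
  · rintro rfl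
    exact betaMap_eq_sub_digit hβ0 hβ2 hx ▸ betaMap_mem_Ico β x
  · fin_cases d
    · exact betaDigits_zero_eq_zero.2 (by simpa using h.2)
    · exact betaDigits_zero_eq_one.2 (by simpa using h.1)

theorem sum_range_betaDigits (hβ0 : 0 < β) (hβ2 : β < 2) {x : ℝ} (hx : x ∈ Icc (0 : ℝ) 1)
    (n : ℕ) : ∑ k ∈ Finset.range n, ((betaDigits β x k : ℕ) : ℝ) * β⁻¹ ^ (k + 1) =
      x - β⁻¹ ^ n * (betaMap β)^[n] x := by
  induction n with
  | zero => simp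
  | succ n ih =>
    have hstep := betaMap_eq_sub_digit hβ0.le hβ2 (iterate_betaMap_mem_Icc (β := β) hx n)
    rw [betaDigits_iterate, add_zero] at hstep
    rw [Finset.sum_range_succ, ih, Function.iterate_succ_apply', hstep, pow_succ]
    field_simp
    ring

theorem hasSum_betaDigits (hβ : β ∈ Ioo (1 : ℝ) 2) {x : ℝ} (hx : x ∈ Icc (0 : ℝ) 1) :
    HasSum (fun k => ((betaDigits β x k : ℕ) : ℝ) * β⁻¹ ^ (k + 1)) x := by
  have hβ0 : 0 < β := one_pos.trans hβ.1
  rw [hasSum_iff_tendsto_nat_of_nonneg fun k => by positivity]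
  simp_rw [sum_range_betaDigits hβ0 hβ.2 hx]
  have hrem : Tendsto (fun n : ℕ => β⁻¹ ^ n * (betaMap β)^[n] x) atTop (𝓝 0) :=
    squeeze_zero (fun n => mul_nonneg (by positivity) (iterate_betaMap_mem_Icc hx n).1)
      (fun n => mul_le_of_le_one_right (by positivity) (iterate_betaMap_mem_Icc hx n).2)
      (tendsto_pow_atTop_nhds_zero_of_lt_one (by positivity) (inv_lt_one_of_one_lt₀ hβ.1))
  simpa using tendsto_const_nhds.sub hrem

/-- The branch `x ↦ β x - d` of the β-transformation maps the points of `[0, a)` with first digit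
`d` onto `[0, branchEnd β d a)`. -/
def branchEnd (β : ℝ) (d : Fin 2) (a : ℝ) : ℝ := max 0 (min 1 (β * a - (d : ℕ)))

theorem branchEnd_mem (β : ℝ) (d : Fin 2) (a : ℝ) : branchEnd β d a ∈ Icc (0 : ℝ) 1 :=
  ⟨le_max_left _ _, max_le zero_le_one (min_le_left _ _)⟩

theorem Ico_inter_digit_inter_preimage_betaMap (hβ0 : 0 < β) (hβ2 : β < 2) (d : Fin 2) {a : ℝ}
    (ha : a ≤ 1) (E : Set ℝ) :
    Ico 0 a ∩ {x | betaDigits β x 0 = d} ∩ betaMap β ⁻¹' E =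
      (fun x => β * x - (d : ℕ)) ⁻¹' (Ico 0 (branchEnd β d a) ∩ E) := by
  ext x
  have hlt : β * x - (d : ℕ) < β * a - (d : ℕ) ↔ x < a := by
    rw [sub_lt_sub_iff_right, mul_lt_mul_iff_right₀ hβ0]
  simp only [mem_inter_iff, mem_Ico, mem_ofPred_eq, mem_preimage, branchEnd, lt_max_iff,
    lt_min_iff, hlt]
  constructor
  · rintro ⟨⟨⟨hx0, hxa⟩, hd⟩, hE⟩
    have hx : x ∈ Icc (0 : ℝ) 1 := ⟨hx0, (hxa.trans_le ha).le⟩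
    have himage := (betaDigits_zero_eq_iff hβ0.le hβ2 hx).1 hd
    rw [betaMap_eq_sub_digit hβ0.le hβ2 hx, hd] at hE
    exact ⟨⟨himage.1, .inr ⟨himage.2, hxa⟩⟩, hE⟩
  · rintro ⟨⟨h0, h⟩, hE⟩
    obtain ⟨h1, hxa⟩ := h.resolve_left h0.not_gt
    have hx0 : 0 ≤ x := nonneg_of_mul_nonneg_right ((Nat.cast_nonneg _).trans (sub_nonneg.1 h0)) hβ0
    have hx : x ∈ Icc (0 : ℝ) 1 := ⟨hx0, (hxa.trans_le ha).le⟩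
    have hd := (betaDigits_zero_eq_iff hβ0.le hβ2 hx).2 ⟨h0, h1⟩
    rw [betaMap_eq_sub_digit hβ0.le hβ2 hx, hd]
    exact ⟨⟨⟨hx0, hxa⟩, rfl⟩, hE⟩

theorem volume_preimage_mul_sub (hβ0 : 0 < β) (c : ℝ) (E : Set ℝ) :
    volume ((fun x => β * x - c) ⁻¹' E) = ENNReal.ofReal β⁻¹ * volume E := by
  have hshift := measure_preimage_add_right volume (-c) E
  have hscale := Real.volume_preimage_mul_left hβ0.ne' ((fun y => y - c) ⁻¹' E)
  rw [abs_of_pos (inv_pos.2 hβ0)] at hscale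
  simp only [← sub_eq_add_neg] at hshift
  rw [← hshift, ← hscale, preimage_preimage]

theorem volume_Ico_inter_digit_inter_preimage_betaMap (hβ0 : 0 < β) (hβ2 : β < 2) (d : Fin 2)
    {a : ℝ} (ha : a ≤ 1) (E : Set ℝ) :
    volume (Ico 0 a ∩ {x | betaDigits β x 0 = d} ∩ betaMap β ⁻¹' E) =
      ENNReal.ofReal β⁻¹ * volume (Ico 0 (branchEnd β d a) ∩ E) := by
  rw [Ico_inter_digit_inter_preimage_betaMap hβ0 hβ2 d ha, volume_preimage_mul_sub hβ0]

theorem branchEnd_eq (hβ0 : 0 ≤ β) (hβ2 : β < 2) (d : Fin 2) {a : ℝ} (ha : a ∈ Icc (0 : ℝ) 1) :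
    branchEnd β d a = if betaDigits β a 0 < d then 0 else if betaDigits β a 0 = d then betaMap β a
      else 1 := by
  have ha0 : 0 ≤ β * a := mul_nonneg hβ0 ha.1
  have ha2 : β * a < 2 := by nlinarith [ha.1, ha.2]
  rw [betaMap_eq_sub_digit hβ0 hβ2 ha]
  rcases lt_or_ge (β * a) 1 with h | h
  · rw [betaDigits_zero_eq_zero.2 h]
    fin_cases d <;> simp [branchEnd, h.le, ha0]
  · rw [betaDigits_zero_eq_one.2 h]
    have ha1 : β * a ≤ 1 + 1 := by linarith
    fin_cases d <;> simp [branchEnd, h, ha1]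

theorem volume_Ico_inter_preimage_betaMap (hβ0 : 0 < β) (hβ2 : β < 2) {a : ℝ}
    (ha : a ∈ Icc (0 : ℝ) 1) (E : Set ℝ) :
    volume (Ico 0 a ∩ betaMap β ⁻¹' E) = ENNReal.ofReal β⁻¹ *
      ((betaDigits β a 0 : ℕ) * volume (Ico 0 1 ∩ E) + volume (Ico 0 (betaMap β a) ∩ E)) := by
  have hm : MeasurableSet {x | betaDigits β x 0 = 0} :=
    (measurable_pi_apply 0).comp (measurable_betaDigits β) (measurableSet_singleton 0)
  have hcompl : {x | betaDigits β x 0 = 0}ᶜ = {x | betaDigits β x 0 = 1} := by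
    ext x
    simp [betaDigits_zero_eq_zero, betaDigits_zero_eq_one]
  rw [← measure_inter_add_sdiff _ hm, sdiff_eq, hcompl, inter_right_comm,
    inter_right_comm _ _ {x | betaDigits β x 0 = 1},
    volume_Ico_inter_digit_inter_preimage_betaMap hβ0 hβ2 0 ha.2,
    volume_Ico_inter_digit_inter_preimage_betaMap hβ0 hβ2 1 ha.2, ← mul_add,
    branchEnd_eq hβ0.le hβ2 0 ha, branchEnd_eq hβ0.le hβ2 1 ha]
  rcases Fin.eq_zero_or_eq_succ (betaDigits β a 0) with h | ⟨j, h⟩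
  · simp [h]
  · simp [h, Subsingleton.elim j 0]

/-- The first `m` symbols of a one-sided sequence. -/
def prefixWord {α : Type*} (m : ℕ) (u : ℕ → α) : Fin m → α := fun i => u i

theorem measurable_prefixWord {α : Type*} [MeasurableSpace α] (m : ℕ) :
    Measurable (prefixWord (α := α) m) :=
  measurable_pi_lambda _ fun i => measurable_pi_apply (i : ℕ)

/-- The points of the line whose first `m` digits form a word in `W`. -/
def digitCylinder (β : ℝ) (m : ℕ) (W : Set (Fin m → Fin 2)) : Set ℝ :=
  {x | prefixWord m (betaDigits β x) ∈ W}

theorem measurableSet_digitCylinder (β : ℝ) (m : ℕ) (W : Set (Fin m → Fin 2)) :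
    MeasurableSet (digitCylinder β m W) :=
  (measurable_prefixWord m).comp (measurable_betaDigits β) W.toFinite.measurableSet

theorem mem_digitCylinder_succ {m : ℕ} {w : Fin (m + 1) → Fin 2} {x : ℝ} :
    x ∈ digitCylinder β (m + 1) {w} ↔
      betaDigits β x 0 = w 0 ∧ betaMap β x ∈ digitCylinder β m {Fin.tail w} := by
  simp only [digitCylinder, mem_ofPred_eq, mem_singleton_iff, funext_iff, Fin.forall_fin_succ]
  rfl

theorem exists_volume_inter_digitCylinder (hβ0 : 0 < β) (hβ2 : β < 2) {m : ℕ} (w : Fin m → Fin 2)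
    {a : ℝ} (ha : a ∈ Icc (0 : ℝ) 1) : ∃ b ∈ Icc (0 : ℝ) 1, ∀ E : Set ℝ,
      volume (Ico 0 a ∩ digitCylinder β m {w} ∩ (betaMap β)^[m] ⁻¹' E) =
        ENNReal.ofReal β⁻¹ ^ m * volume (Ico 0 b ∩ E) := by
  induction m generalizing a with
  | zero => exact ⟨a, ha, fun E => by simp [digitCylinder, Subsingleton.elim _ w]⟩
  | succ m ih =>
    obtain ⟨b, hb, hvol⟩ := ih (Fin.tail w) (branchEnd_mem β (w 0) a)
    refine ⟨b, hb, fun E => ?_⟩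
    rw [pow_succ', mul_assoc, ← hvol, inter_assoc (Ico 0 (branchEnd β (w 0) a)),
      ← volume_Ico_inter_digit_inter_preimage_betaMap hβ0 hβ2 (w 0) ha.2]
    congr 1
    ext x
    simp only [mem_inter_iff, mem_preimage, mem_ofPred_eq, mem_digitCylinder_succ,
      Function.iterate_succ_apply, and_assoc]

end BetaMap

/-! ### Parry's measure on the interval -/

section ParryInterval

variable {β : ℝ}

theorem parryUnnormalized_apply {E : Set ℝ} (hE : MeasurableSet E) :
    parryUnnormalized β E =
      ∑' n : ℕ, ENNReal.ofReal (β⁻¹ ^ n) * volume (Ico 0 ((betaMap β)^[n] 1) ∩ E) := by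
  rw [parryUnnormalized, withDensity_apply _ hE, Measure.restrict_restrict hE, lintegral_tsum
    fun n => (Measurable.ite measurableSet_Iio measurable_const measurable_const).aemeasurable]
  refine tsum_congr fun n => ?_
  have hle : (betaMap β)^[n] 1 ≤ 1 := (iterate_betaMap_mem_Icc unitInterval.one_mem n).2
  have hIco : Ico 0 ((betaMap β)^[n] 1) ∩ E = Iio ((betaMap β)^[n] 1) ∩ (E ∩ Ico 0 1) := by
    ext x
    simp only [mem_inter_iff, mem_Ico, mem_Iio]
    exact ⟨fun h => ⟨h.1.2, h.2, h.1.1, h.1.2.trans_le hle⟩, fun h => ⟨⟨h.2.2.1, h.1⟩, h.2.1⟩⟩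
  rw [hIco, ← Measure.restrict_apply measurableSet_Iio,
    ← lintegral_indicator_const measurableSet_Iio]
  rfl

/-- The total mass of the weights `β⁻ⁿ`, which bounds Parry's density. -/
def parryBound (β : ℝ) : ENNReal := ∑' n : ℕ, ENNReal.ofReal (β⁻¹ ^ n)

theorem parryBound_ne_top (hβ : 1 < β) : parryBound β ≠ ⊤ := by
  have hβ0 : 0 ≤ β⁻¹ := inv_nonneg.2 (zero_le_one.trans hβ.le)
  rw [parryBound, ← ENNReal.ofReal_tsum_of_nonneg (fun n => pow_nonneg hβ0 n)
    (summable_geometric_of_lt_one hβ0 (inv_lt_one_of_one_lt₀ hβ))]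
  exact ENNReal.ofReal_ne_top

theorem volume_le_parryUnnormalized {E : Set ℝ} (hE : MeasurableSet E) :
    volume (Ico 0 1 ∩ E) ≤ parryUnnormalized β E := by
  rw [parryUnnormalized_apply hE]
  refine le_trans (le_of_eq ?_) (ENNReal.le_tsum 0)
  simp

theorem parryUnnormalized_le_volume {E : Set ℝ} (hE : MeasurableSet E) :
    parryUnnormalized β E ≤ parryBound β * volume (Ico 0 1 ∩ E) := by
  rw [parryUnnormalized_apply hE, parryBound, ← ENNReal.tsum_mul_right]
  gcongr with n
  exact (iterate_betaMap_mem_Icc unitInterval.one_mem n).2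

/- The transfer operator sends the term `β⁻ⁿ 1_{[0, Tⁿ1)}` of Parry's density to the next term plus
the constant `β⁻⁽ⁿ⁺¹⁾` times the `n`-th digit of `1`. These constants add up to `1`, which restores
the term `n = 0`. -/
theorem parryUnnormalized_preimage_betaMap (hβ : β ∈ Ioo (1 : ℝ) 2) {E : Set ℝ}
    (hE : MeasurableSet E) : parryUnnormalized β (betaMap β ⁻¹' E) = parryUnnormalized β E := by
  have hβ0 : 0 < β := one_pos.trans hβ.1
  have hone := hasSum_betaDigits hβ unitInterval.one_mem
  have hterm : ∀ n : ℕ, ENNReal.ofReal (β⁻¹ ^ n) *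
      volume (Ico 0 ((betaMap β)^[n] 1) ∩ betaMap β ⁻¹' E) =
      ENNReal.ofReal (((betaDigits β 1 n : ℕ) : ℝ) * β⁻¹ ^ (n + 1)) * volume (Ico 0 1 ∩ E) +
      ENNReal.ofReal (β⁻¹ ^ (n + 1)) * volume (Ico 0 ((betaMap β)^[n + 1] 1) ∩ E) := by
    intro n
    rw [volume_Ico_inter_preimage_betaMap hβ0 hβ.2
        (iterate_betaMap_mem_Icc unitInterval.one_mem n), betaDigits_iterate, add_zero,
      Function.iterate_succ_apply', ← mul_assoc, ← ENNReal.ofReal_mul (by positivity), ← pow_succ,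
      ENNReal.ofReal_mul (by positivity), ENNReal.ofReal_natCast]
    ring
  rw [parryUnnormalized_apply hE, parryUnnormalized_apply (measurable_betaMap β hE),
    tsum_congr hterm, ENNReal.tsum_add, ENNReal.tsum_mul_right,
    ← ENNReal.ofReal_tsum_of_nonneg (fun n => by positivity) hone.summable, hone.tsum_eq,
    tsum_eq_zero_add' ENNReal.summable (f := fun n : ℕ => ENNReal.ofReal (β⁻¹ ^ n) *
      volume (Ico 0 ((betaMap β)^[n] 1) ∩ E))]
  simp

theorem one_le_parryUnnormalized_univ (β : ℝ) : 1 ≤ parryUnnormalized β univ := by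
  simpa using volume_le_parryUnnormalized (β := β) MeasurableSet.univ

theorem parryUnnormalized_univ_ne_top (hβ : 1 < β) : parryUnnormalized β univ ≠ ⊤ :=
  ne_top_of_le_ne_top (parryBound_ne_top hβ)
    (by simpa using parryUnnormalized_le_volume (β := β) MeasurableSet.univ)

theorem isProbabilityMeasure_parryInterval (hβ : 1 < β) :
    IsProbabilityMeasure (parryInterval β) where
  measure_univ := by
    rw [parryInterval, Measure.smul_apply, smul_eq_mul]
    exact ENNReal.inv_mul_cancel (one_pos.trans_le (one_le_parryUnnormalized_univ β)).ne'
      (parryUnnormalized_univ_ne_top hβ)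

theorem measurePreserving_betaMap (hβ : β ∈ Ioo (1 : ℝ) 2) :
    MeasurePreserving (betaMap β) (parryInterval β) (parryInterval β) := by
  refine ⟨measurable_betaMap β, Measure.ext fun E hE => ?_⟩
  rw [Measure.map_apply (measurable_betaMap β) hE, parryInterval, Measure.smul_apply,
    Measure.smul_apply, parryUnnormalized_preimage_betaMap hβ hE]

theorem parryInterval_le_volume {E : Set ℝ} (hE : MeasurableSet E) :
    parryInterval β E ≤ parryBound β * volume (Ico 0 1 ∩ E) := by
  rw [parryInterval, Measure.smul_apply, smul_eq_mul]
  exact (mul_le_of_le_one_left' (ENNReal.inv_le_one.2 (one_le_parryUnnormalized_univ β))).trans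
    (parryUnnormalized_le_volume hE)

theorem parryInterval_absolutelyContinuous (β : ℝ) : parryInterval β ≪ volume :=
  .mk fun E hE h0 => by
    simpa [measure_mono_null inter_subset_right h0] using parryInterval_le_volume (β := β) hE

theorem ae_parryInterval_mem_Ico (β : ℝ) : ∀ᵐ x ∂parryInterval β, x ∈ Ico (0 : ℝ) 1 := by
  have h := parryInterval_le_volume (β := β) (measurableSet_Ico (a := (0 : ℝ)) (b := 1)).compl
  rw [inter_compl_self, measure_empty, mul_zero] at h
  exact mem_ae_iff.2 (nonpos_iff_eq_zero.1 h)

theorem volume_inter_digitCylinder_le (hβ0 : 0 < β) (hβ2 : β < 2) {m : ℕ} (w : Fin m → Fin 2) :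
    volume (Ico 0 1 ∩ digitCylinder β m {w}) ≤ ENNReal.ofReal β⁻¹ ^ m := by
  obtain ⟨b, hb, hvol⟩ := exists_volume_inter_digitCylinder hβ0 hβ2 w unitInterval.one_mem
  have h := hvol univ
  rw [preimage_univ, inter_univ, inter_univ, Real.volume_Ico, sub_zero] at h
  rw [h]
  exact mul_le_of_le_one_right' (ENNReal.ofReal_le_one.2 hb.2)

theorem parryInterval_digitCylinder_le (hβ0 : 0 < β) (hβ2 : β < 2) {m : ℕ} (w : Fin m → Fin 2) :
    parryInterval β (digitCylinder β m {w}) ≤ parryBound β * ENNReal.ofReal β⁻¹ ^ m := by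
  grw [parryInterval_le_volume (measurableSet_digitCylinder β m {w}),
    volume_inter_digitCylinder_le hβ0 hβ2 w]

theorem volume_le_volume_preimage_iterate (hβ : β ∈ Ioo (1 : ℝ) 2) {D : Set ℝ}
    (hD : MeasurableSet D) (n : ℕ) :
    volume (Ico 0 1 ∩ D) ≤ parryBound β * volume (Ico 0 1 ∩ (betaMap β)^[n] ⁻¹' D) := by
  have hT : MeasurePreserving (betaMap β) (parryUnnormalized β) (parryUnnormalized β) := by
    refine ⟨measurable_betaMap β, Measure.ext fun E hE => ?_⟩
    rw [Measure.map_apply (measurable_betaMap β) hE, parryUnnormalized_preimage_betaMap hβ hE]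
  calc volume (Ico 0 1 ∩ D) ≤ parryUnnormalized β D := volume_le_parryUnnormalized hD
    _ = parryUnnormalized β ((betaMap β)^[n] ⁻¹' D) :=
        ((hT.iterate n).measure_preimage hD.nullMeasurableSet).symm
    _ ≤ _ := parryUnnormalized_le_volume ((measurable_betaMap β).iterate n hD)

/- The interval `[0, a)` is stretched by `β` until its image contains `[0, 1)`, after at most `k`
steps; from then on `volume_le_volume_preimage_iterate` applies. -/
theorem volume_Ico_le_volume_preimage_iterate (hβ : β ∈ Ioo (1 : ℝ) 2) {D : Set ℝ}
    (hD : MeasurableSet D) (k : ℕ) {a : ℝ} (ha : a ∈ Icc (0 : ℝ) 1) (hk : 1 ≤ β ^ k * a) {n : ℕ}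
    (hn : k ≤ n) :
    ENNReal.ofReal a * volume (Ico 0 1 ∩ D) ≤
      ENNReal.ofReal β * parryBound β * volume (Ico 0 a ∩ (betaMap β)^[n] ⁻¹' D) := by
  have hβ0 : 0 < β := one_pos.trans hβ.1
  have hcancel : ENNReal.ofReal β * ENNReal.ofReal β⁻¹ = 1 := by
    rw [← ENNReal.ofReal_mul hβ0.le, mul_inv_cancel₀ hβ0.ne', ENNReal.ofReal_one]
  induction k generalizing a n with
  | zero =>
    obtain rfl : a = 1 := le_antisymm ha.2 (by simpa using hk)
    rw [ENNReal.ofReal_one, one_mul, mul_assoc]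
    exact (volume_le_volume_preimage_iterate hβ hD n).trans
      (le_mul_of_one_le_left' (ENNReal.one_le_ofReal.2 hβ.1.le))
  | succ k ih =>
    obtain ⟨n, rfl⟩ := Nat.exists_eq_add_of_le' (Nat.le_of_add_left_le hn)
    rw [Function.iterate_succ, preimage_comp, volume_Ico_inter_preimage_betaMap hβ0 hβ.2 ha,
      mul_right_comm, ← mul_assoc, hcancel, one_mul, mul_comm (_ + _)]
    rcases lt_or_ge (β * a) 1 with h | h
    · have hmap := betaMap_eq_sub_digit hβ0.le hβ.2 ha
      rw [betaDigits_zero_eq_zero.2 h, Fin.val_zero, Nat.cast_zero, sub_zero] at hmap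
      have hstretch := ih (a := β * a) (n := n) ⟨mul_nonneg hβ0.le ha.1, h.le⟩
        (by rwa [← mul_assoc, ← pow_succ]) (by omega)
      rw [betaDigits_zero_eq_zero.2 h, Fin.val_zero, Nat.cast_zero, zero_mul, zero_add, hmap]
      rwa [ENNReal.ofReal_mul hβ0.le, mul_assoc, mul_assoc, ENNReal.mul_le_mul_iff_right
        (ENNReal.ofReal_pos.2 hβ0).ne' ENNReal.ofReal_ne_top] at hstretch
    · rw [betaDigits_zero_eq_one.2 h, Fin.val_one, Nat.cast_one, one_mul, mul_add]
      exact (mul_le_of_le_one_left' (ENNReal.ofReal_le_one.2 ha.2)).trans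
        ((volume_le_volume_preimage_iterate hβ hD n).trans le_self_add)

theorem eventually_volume_mul_volume_le (hβ : β ∈ Ioo (1 : ℝ) 2) {m : ℕ} (w : Fin m → Fin 2) :
    ∀ᶠ n in atTop, ∀ D : Set ℝ, MeasurableSet D →
      volume (Ico 0 1 ∩ digitCylinder β m {w}) * volume (Ico 0 1 ∩ D) ≤
        ENNReal.ofReal β * parryBound β *
          volume (Ico 0 1 ∩ digitCylinder β m {w} ∩ (betaMap β)^[n] ⁻¹' D) := by
  obtain ⟨b, hb, hcyl⟩ := exists_volume_inter_digitCylinder (one_pos.trans hβ.1) hβ.2 w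
    unitInterval.one_mem
  have hvol := hcyl univ
  rw [preimage_univ, inter_univ, inter_univ, Real.volume_Ico, sub_zero] at hvol
  rcases hb.1.eq_or_lt with hb0 | hb0
  · simp [hvol, ← hb0]
  obtain ⟨k, hk⟩ := pow_unbounded_of_one_lt b⁻¹ hβ.1
  filter_upwards [eventually_ge_atTop (m + k)] with n hn D hD
  obtain ⟨n, rfl⟩ := Nat.exists_eq_add_of_le (le_of_add_le_left hn)
  rw [add_comm m, Function.iterate_add, preimage_comp, hcyl, hvol, mul_assoc,
    mul_left_comm _ (ENNReal.ofReal β⁻¹ ^ m)]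
  grw [volume_Ico_le_volume_preimage_iterate hβ hD k hb ((inv_le_iff_one_le_mul₀ hb0).1 hk.le)
    (n := n) (by omega)]

theorem sum_volume_inter_digitCylinder {m : ℕ} (W : Finset (Fin m → Fin 2)) {E : Set ℝ}
    (hE : MeasurableSet E) :
    ∑ w ∈ W, volume (Ico 0 1 ∩ digitCylinder β m {w} ∩ E) =
      volume (Ico 0 1 ∩ digitCylinder β m W ∩ E) := by
  have hrestrict : ∀ V : Set (Fin m → Fin 2), volume (Ico 0 1 ∩ digitCylinder β m V ∩ E) =
      volume.restrict (Ico 0 1 ∩ E) ((fun x => prefixWord m (betaDigits β x)) ⁻¹' V) := fun V => by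
    rw [Measure.restrict_apply' (measurableSet_Ico.inter hE), inter_right_comm, inter_comm]
    rfl
  simp_rw [hrestrict]
  exact sum_measure_preimage_singleton W fun w _ => measurableSet_digitCylinder β m {w}

theorem eventually_volume_digitCylinder_mul_le (hβ : β ∈ Ioo (1 : ℝ) 2) {m : ℕ}
    (W : Set (Fin m → Fin 2)) :
    ∀ᶠ n in atTop, ∀ D : Set ℝ, MeasurableSet D →
      volume (Ico 0 1 ∩ digitCylinder β m W) * volume (Ico 0 1 ∩ D) ≤
        ENNReal.ofReal β * parryBound β *
          volume (Ico 0 1 ∩ digitCylinder β m W ∩ (betaMap β)^[n] ⁻¹' D) := by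
  lift W to Finset (Fin m → Fin 2) using W.toFinite
  filter_upwards [eventually_all.2 fun w => eventually_volume_mul_volume_le hβ w] with n hn D hD
  have hsum := sum_volume_inter_digitCylinder (β := β) W MeasurableSet.univ
  simp only [inter_univ] at hsum
  rw [← hsum, ← sum_volume_inter_digitCylinder W ((measurable_betaMap β).iterate n hD),
    Finset.sum_mul, Finset.mul_sum]
  exact Finset.sum_le_sum fun w _ => hn w D hD

theorem volume_le_mul_parryInterval (hβ : 1 < β) {E : Set ℝ} (hE : MeasurableSet E) :
    volume (Ico 0 1 ∩ E) ≤ parryUnnormalized β univ * parryInterval β E := by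
  rw [parryInterval, Measure.smul_apply, smul_eq_mul, ← mul_assoc, ENNReal.mul_inv_cancel
    (one_pos.trans_le (one_le_parryUnnormalized_univ β)).ne' (parryUnnormalized_univ_ne_top hβ),
    one_mul]
  exact volume_le_parryUnnormalized hE

theorem exists_parryInterval_digitCylinder_mul_le (hβ : β ∈ Ioo (1 : ℝ) 2) :
    ∃ Q : ENNReal, Q ≠ ⊤ ∧ ∀ (m : ℕ) (W : Set (Fin m → Fin 2)),
    ∀ᶠ n in atTop, ∀ D : Set ℝ, MeasurableSet D →
      parryInterval β (digitCylinder β m W) * parryInterval β D ≤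
        Q * parryInterval β (digitCylinder β m W ∩ (betaMap β)^[n] ⁻¹' D) := by
  set K := parryBound β
  have hK : K ≠ ⊤ := parryBound_ne_top hβ.1
  set c := parryUnnormalized β univ
  refine ⟨K * K * (ENNReal.ofReal β * K * c), ?_, fun m W => ?_⟩
  · exact ENNReal.mul_ne_top (ENNReal.mul_ne_top hK hK) (ENNReal.mul_ne_top
      (ENNReal.mul_ne_top ENNReal.ofReal_ne_top hK) (parryUnnormalized_univ_ne_top hβ.1))
  filter_upwards [eventually_volume_digitCylinder_mul_le hβ W] with n hn D hD
  have hC := measurableSet_digitCylinder β m W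
  have hCD := hC.inter ((measurable_betaMap β).iterate n hD)
  calc parryInterval β (digitCylinder β m W) * parryInterval β D
      ≤ (K * volume (Ico 0 1 ∩ digitCylinder β m W)) * (K * volume (Ico 0 1 ∩ D)) :=
        mul_le_mul' (parryInterval_le_volume hC) (parryInterval_le_volume hD)
    _ = K * K * (volume (Ico 0 1 ∩ digitCylinder β m W) * volume (Ico 0 1 ∩ D)) := by ring
    _ ≤ K * K * (ENNReal.ofReal β * K *
        volume (Ico 0 1 ∩ (digitCylinder β m W ∩ (betaMap β)^[n] ⁻¹' D))) := by
        rw [← inter_assoc]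
        grw [hn D hD]
    _ ≤ K * K * (ENNReal.ofReal β * K *
        (c * parryInterval β (digitCylinder β m W ∩ (betaMap β)^[n] ⁻¹' D))) := by
        gcongr
        exact volume_le_mul_parryInterval hβ.1 hCD
    _ = _ := by ring

end ParryInterval

/-! ### Counting admissible words -/

section OrbitWords

variable {β : ℝ}

/-- The words of length `n` that are read off along orbit segments `x_{i+1} = β x_i - w_i` in
`[0,1]` with `x_0 ≤ a`. They comprise the β-admissible words and have the same growth rate. -/
def orbitWords (β : ℝ) (n : ℕ) (a : ℝ) : Set (Fin n → Fin 2) :=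
  {w | ∃ x : ℕ → ℝ, x 0 ≤ a ∧ (∀ i ≤ n, x i ∈ Icc (0 : ℝ) 1) ∧
    ∀ i : Fin n, x (i + 1) = β * x i - ((w i : ℕ) : ℝ)}

theorem tail_mem_orbitWords (hβ0 : 0 ≤ β) {n : ℕ} {a : ℝ} {w : Fin (n + 1) → Fin 2}
    (hw : w ∈ orbitWords β (n + 1) a) :
    Fin.tail w ∈ orbitWords β n (min 1 (β * a - (w 0 : ℕ))) ∧ (w 0 : ℕ) ≤ β * a := by
  obtain ⟨x, hxa, hx, hrec⟩ := hw
  have hx1 : x 1 = β * x 0 - (w 0 : ℕ) := hrec 0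
  have hle : x 1 ≤ β * a - (w 0 : ℕ) := by rw [hx1]; gcongr
  have hmem := hx 1 (by omega)
  exact ⟨⟨fun i => x (i + 1), le_min hmem.2 hle, fun i hi => hx _ (by omega),
    fun i => hrec i.succ⟩, sub_nonneg.1 (hmem.1.trans hle)⟩

theorem orbitWords_succ_subset (hβ0 : 0 ≤ β) (hβ2 : β < 2) {n : ℕ} {a : ℝ}
    (ha : a ∈ Icc (0 : ℝ) 1) : orbitWords β (n + 1) a ⊆
      {w | w 0 = betaDigits β a 0 ∧ Fin.tail w ∈ orbitWords β n (betaMap β a)} ∪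
        {w | w 0 = 0 ∧ betaDigits β a 0 = 1 ∧ Fin.tail w ∈ orbitWords β n 1} := by
  intro w hw
  obtain ⟨htail, hle⟩ := tail_mem_orbitWords hβ0 hw
  have hmono : ∀ {b c : ℝ}, b ≤ c → orbitWords β n b ⊆ orbitWords β n c :=
    fun hbc v ⟨x, hx, h⟩ => ⟨x, hx.trans hbc, h⟩
  by_cases hd : w 0 = betaDigits β a 0
  · refine .inl ⟨hd, hmono ?_ htail⟩
    rw [hd, ← betaMap_eq_sub_digit hβ0 hβ2 ha]
    exact min_le_right _ _
  · refine .inr ?_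
    rcases lt_or_ge (β * a) 1 with h | h
    · rw [betaDigits_zero_eq_zero.2 h] at hd
      rw [Fin.eq_one_of_ne_zero _ hd, Fin.val_one, Nat.cast_one] at hle
      exact absurd hle h.not_ge
    · rw [betaDigits_zero_eq_one.2 h] at hd ⊢
      exact ⟨by omega, rfl, hmono (min_le_left _ _) htail⟩

theorem ncard_head_eq_tail_mem_le {α : Type*} [Finite α] {n : ℕ} (d : α) (S : Set (Fin n → α)) :
    {w : Fin (n + 1) → α | w 0 = d ∧ Fin.tail w ∈ S}.ncard ≤ S.ncard := by
  refine ncard_le_ncard_of_injOn Fin.tail (fun w hw => hw.2) (fun v hv w hw htail => ?_) S.toFinite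
  rw [← Fin.cons_self_tail v, ← Fin.cons_self_tail w, hv.1, hw.1, htail]

theorem ncard_orbitWords_succ_le (hβ0 : 0 ≤ β) (hβ2 : β < 2) (n : ℕ) {a : ℝ}
    (ha : a ∈ Icc (0 : ℝ) 1) : (orbitWords β (n + 1) a).ncard ≤
      (orbitWords β n (betaMap β a)).ncard +
        (betaDigits β a 0 : ℕ) * (orbitWords β n 1).ncard := by
  refine (ncard_le_ncard (orbitWords_succ_subset hβ0 hβ2 ha) (toFinite _)).trans
    ((ncard_union_le _ _).trans (add_le_add (ncard_head_eq_tail_mem_le _ _) ?_))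
  by_cases hd : betaDigits β a 0 = 1
  · simpa [hd] using ncard_head_eq_tail_mem_le 0 (orbitWords β n 1)
  · simp [hd]

theorem ncard_orbitWords_le_sum (hβ0 : 0 < β) (hβ2 : β < 2) (n : ℕ) {a : ℝ}
    (ha : a ∈ Icc (0 : ℝ) 1) :
    ((orbitWords β n a).ncard : ℝ) ≤ (∑ j ∈ Finset.range n, β⁻¹ ^ j) * a * β ^ n + 1 := by
  induction n generalizing a with
  | zero => simpa using ncard_le_one_of_subsingleton (orbitWords β 0 a)
  | succ n ih =>
    have hmap := betaMap_eq_sub_digit hβ0.le hβ2 ha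
    have hmap_mem := Ico_subset_Icc_self (betaMap_mem_Ico β a)
    have hrec : ((orbitWords β (n + 1) a).ncard : ℝ) ≤ (orbitWords β n (betaMap β a)).ncard +
        (betaDigits β a 0 : ℕ) * (orbitWords β n 1).ncard := by
      exact_mod_cast ncard_orbitWords_succ_le hβ0.le hβ2 n ha
    have hpow : β⁻¹ ^ n * β ^ n = 1 := by rw [← mul_pow, inv_mul_cancel₀ hβ0.ne', one_pow]
    rw [Finset.sum_range_succ, pow_succ]
    calc _ ≤ _ := hrec
      _ ≤ ((∑ j ∈ Finset.range n, β⁻¹ ^ j) * betaMap β a * β ^ n + 1) + (betaDigits β a 0 : ℕ) *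
          ((∑ j ∈ Finset.range n, β⁻¹ ^ j) * 1 * β ^ n + 1) := by
          gcongr
          · exact ih hmap_mem
          · exact ih unitInterval.one_mem
      _ = (∑ j ∈ Finset.range n, β⁻¹ ^ j) * (β * a) * β ^ n + (β * a - betaMap β a) + 1 := by
          rw [hmap]
          ring
      _ ≤ (∑ j ∈ Finset.range n, β⁻¹ ^ j) * (β * a) * β ^ n + β * a + 1 := by
          linarith [hmap_mem.1]
      _ = _ := by linear_combination -(a * β) * hpow

theorem exists_ncard_orbitWords_le (hβ : β ∈ Ioo (1 : ℝ) 2) :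
    ∃ C : ℝ, 0 < C ∧ ∀ n, ((orbitWords β n 1).ncard : ℝ) ≤ C * β ^ n := by
  have hβ0 : 0 < β := one_pos.trans hβ.1
  have hsum := summable_geometric_of_lt_one (inv_nonneg.2 hβ0.le) (inv_lt_one_of_one_lt₀ hβ.1)
  have hC : 0 ≤ ∑' j : ℕ, β⁻¹ ^ j := tsum_nonneg fun j => by positivity
  refine ⟨(∑' j : ℕ, β⁻¹ ^ j) + 1, add_pos_of_nonneg_of_pos hC one_pos, fun n => ?_⟩
  grw [ncard_orbitWords_le_sum hβ0 hβ.2 n unitInterval.one_mem, mul_one, add_mul, one_mul,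
    hsum.sum_le_tsum (Finset.range n) fun j _ => by positivity]
  gcongr
  exact one_le_pow₀ hβ.1.le

theorem prefixWord_betaDigits_mem_orbitWords (hβ0 : 0 ≤ β) (hβ2 : β < 2) (m : ℕ) {x : ℝ}
    (hx : x ∈ Icc (0 : ℝ) 1) : prefixWord m (betaDigits β x) ∈ orbitWords β m 1 := by
  refine ⟨fun i => (betaMap β)^[i] x, hx.2, fun i _ => iterate_betaMap_mem_Icc hx i, fun i => ?_⟩
  beta_reduce
  rw [Function.iterate_succ_apply', betaMap_eq_sub_digit hβ0 hβ2 (iterate_betaMap_mem_Icc hx i),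
    betaDigits_iterate, add_zero]
  rfl

end OrbitWords

/-! ### Existence of the Parry measure -/

section DigitSeries

/-- The power series `∑ u_k r^k`. With `u = (s_{-1}, s_{-2}, …)` and `r = β⁻¹` it is, up to a factor
`β⁻¹`, the expansion in base `β`, and with `u = (s_0, s_1, …)` and `r = τ` it is, up to a factor
`1 - τ`, the vertical coordinate of the coding map. -/
def digitSeries (r : ℝ) (u : ℕ → Fin 2) : ℝ := ∑' k, ((u k : ℕ) : ℝ) * r ^ k

variable {r : ℝ}

theorem norm_digit_mul_pow_le (r : ℝ) (u : ℕ → Fin 2) (k : ℕ) :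
    ‖((u k : ℕ) : ℝ) * r ^ k‖ ≤ |r| ^ k := by
  have hdigit : ((u k : ℕ) : ℝ) ≤ 1 := mod_cast Fin.is_le (u k)
  rw [norm_mul, norm_pow, Real.norm_natCast, Real.norm_eq_abs]
  exact mul_le_of_le_one_left (by positivity) hdigit

theorem summable_digitSeries (hr : |r| < 1) (u : ℕ → Fin 2) :
    Summable fun k => ((u k : ℕ) : ℝ) * r ^ k :=
  .of_norm_bounded (summable_geometric_of_lt_one (abs_nonneg r) hr) (norm_digit_mul_pow_le r u)

theorem continuous_digitSeries (hr : |r| < 1) : Continuous (digitSeries r) :=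
  have hval : Continuous fun d : Fin 2 => ((d : ℕ) : ℝ) := continuous_of_discreteTopology
  continuous_tsum (fun k => (hval.comp (continuous_apply k)).mul_const _)
    (summable_geometric_of_lt_one (abs_nonneg r) hr) fun k u => norm_digit_mul_pow_le r u k

theorem digitSeries_nonneg (hr : 0 ≤ r) (u : ℕ → Fin 2) : 0 ≤ digitSeries r u :=
  tsum_nonneg fun _ => by positivity

theorem digitSeries_le (hr0 : 0 ≤ r) (hr1 : r < 1) (u : ℕ → Fin 2) :
    digitSeries r u ≤ (1 - r)⁻¹ := by
  rw [← tsum_geometric_of_lt_one hr0 hr1]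
  have habs : |r| = r := abs_of_nonneg hr0
  refine (summable_digitSeries (habs.trans_lt hr1) u).tsum_le_tsum (fun k => ?_)
    (summable_geometric_of_lt_one hr0 hr1)
  simpa only [habs] using (le_abs_self _).trans (norm_digit_mul_pow_le r u k)

theorem digitSeries_eq_head_add (hr : |r| < 1) (u : ℕ → Fin 2) :
    digitSeries r u = (u 0 : ℕ) + r * digitSeries r fun k => u (k + 1) := by
  rw [digitSeries, (summable_digitSeries hr u).tsum_eq_zero_add, digitSeries, ← tsum_mul_left]
  simp only [pow_zero, mul_one, pow_succ', mul_left_comm]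

theorem tsum_digit_mul_pow_succ (r : ℝ) (u : ℕ → Fin 2) :
    ∑' k, ((u k : ℕ) : ℝ) * r ^ (k + 1) = r * digitSeries r u := by
  simp only [digitSeries, ← tsum_mul_left, pow_succ', mul_left_comm]

theorem inv_mul_digitSeries_betaDigits {β : ℝ} (hβ : β ∈ Ioo (1 : ℝ) 2) {x : ℝ}
    (hx : x ∈ Icc (0 : ℝ) 1) : β⁻¹ * digitSeries β⁻¹ (betaDigits β x) = x := by
  rw [← tsum_digit_mul_pow_succ, (hasSum_betaDigits hβ hx).tsum_eq]

theorem abs_inv_lt_one {β : ℝ} (hβ : 1 < β) : |β⁻¹| < 1 := by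
  rw [abs_of_pos (inv_pos.2 (one_pos.trans hβ))]
  exact inv_lt_one_of_one_lt₀ hβ

end DigitSeries

section PastPlace

/-- The one-sided sequence `s_{j-1}, s_{j-2}, …`. -/
def past (j : ℤ) (s : ℤ → Fin 2) : ℕ → Fin 2 := fun k => s (j - (k + 1))

/-- The two-sided sequence `s` with `s_{j-1-k} = u_k` for `k ≥ 0` and zeros elsewhere. -/
def place (j : ℤ) (u : ℕ → Fin 2) : ℤ → Fin 2 := fun k => if k < j then u (j - 1 - k).toNat else 0

theorem continuous_past (j : ℤ) : Continuous (past j) :=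
  continuous_pi fun _ => continuous_apply _

theorem measurable_past (j : ℤ) : Measurable (past j) := (continuous_past j).measurable

theorem measurable_place (j : ℤ) : Measurable (place j) :=
  measurable_pi_lambda _ fun k => by
    unfold place
    split_ifs
    · exact measurable_pi_apply _
    · exact measurable_const

theorem past_place {j n : ℤ} (h : j ≤ n) (u : ℕ → Fin 2) (k : ℕ) :
    past j (place n u) k = u ((n - j).toNat + k) := by
  rw [past, place, if_pos (by lia)]
  congr 1
  lia

theorem place_past_apply {j k : ℤ} (h : k < j) (s : ℤ → Fin 2) : place j (past j s) k = s k := by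
  rw [place, if_pos h, past]
  congr 1
  lia

theorem past_shift (j : ℤ) (s : ℤ → Fin 2) : past j (shift s) = past (j - 1) s := by
  funext k
  simp only [past, shift]
  congr 1
  ring

theorem past_succ_zero (j : ℤ) (s : ℤ → Fin 2) : past (j + 1) s 0 = s j := by
  simp [past]

theorem past_succ_succ (j : ℤ) (s : ℤ → Fin 2) (k : ℕ) : past (j + 1) s (k + 1) = past j s k := by
  simp only [past, Nat.cast_succ]
  congr 1
  ring

theorem exists_window_of_mem_measurableCylinders {t : Set (ℤ → Fin 2)}
    (ht : t ∈ measurableCylinders fun _ : ℤ => Fin 2) :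
    ∃ N₀ : ℕ, ∀ s s' : ℤ → Fin 2, (∀ k : ℤ, -N₀ ≤ k → k < N₀ → s k = s' k) → (s ∈ t ↔ s' ∈ t) := by
  obtain ⟨I, S, -, rfl⟩ := (mem_measurableCylinders t).1 ht
  refine ⟨I.sup Int.natAbs + 1, fun s s' hss' => ?_⟩
  have hrestrict : I.restrict s = I.restrict s' := by
    funext i
    have hi := Finset.le_sup (f := Int.natAbs) i.2
    exact hss' i (by lia) (by lia)
  rw [mem_cylinder, mem_cylinder, hrestrict]

theorem ext_of_map_past {L L' : Measure (ℤ → Fin 2)} [IsProbabilityMeasure L]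
    [IsProbabilityMeasure L'] (h : ∀ j, L.map (past j) = L'.map (past j)) : L = L' := by
  refine ext_of_generate_finite _ generateFrom_measurableCylinders.symm
    isPiSystem_measurableCylinders (fun t ht => ?_) (by simp)
  obtain ⟨N, hN⟩ := exists_window_of_mem_measurableCylinders ht
  have ht_eq : t = past N ⁻¹' (place N ⁻¹' t) := by
    ext s
    exact hN _ _ fun k _ hk => (place_past_apply hk s).symm
  have hmeas : MeasurableSet (place N ⁻¹' t) :=
    measurable_place _ (.of_mem_measurableCylinders ht)
  rw [ht_eq, ← Measure.map_apply (measurable_past N) hmeas, h,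
    Measure.map_apply (measurable_past N) hmeas]

end PastPlace

section ParryMeasure

variable {β : ℝ}

theorem mem_preBetaShift_iff {s : ℤ → Fin 2} :
    s ∈ preBetaShift β ↔ ∀ i, β⁻¹ * digitSeries β⁻¹ (past i s) < 1 :=
  forall_congr' fun _ => by rw [← tsum_digit_mul_pow_succ]; rfl

theorem past_place_betaDigits {j n : ℤ} (h : j ≤ n) (x : ℝ) :
    past j (place n (betaDigits β x)) = betaDigits β ((betaMap β)^[(n - j).toNat] x) := by
  funext k
  rw [past_place h, betaDigits_iterate]

theorem place_betaDigits_mem_preBetaShift (hβ : β ∈ Ioo (1 : ℝ) 2) (n : ℤ) {x : ℝ}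
    (hx : x ∈ Ico (0 : ℝ) 1) : place n (betaDigits β x) ∈ preBetaShift β := by
  have hle : ∀ i ≤ n, β⁻¹ * digitSeries β⁻¹ (past i (place n (betaDigits β x))) < 1 := by
    intro i hi
    have hmem := iterate_betaMap_mem_Ico (β := β) hx (n - i).toNat
    rw [past_place_betaDigits hi, inv_mul_digitSeries_betaDigits hβ (Ico_subset_Icc_self hmem)]
    exact hmem.2
  refine mem_preBetaShift_iff.2 fun i => (le_total i n).elim (hle i) fun hi => ?_
  induction i, hi using Int.leInduction with
  | base => exact hle n le_rfl
  | succ i hi ih =>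
    have hzero : place n (betaDigits β x) i = 0 := if_neg hi.not_gt
    rw [digitSeries_eq_head_add (abs_inv_lt_one hβ.1), past_succ_zero, hzero]
    simp only [past_succ_succ, Fin.val_zero, Nat.cast_zero, zero_add]
    nlinarith [inv_pos.2 (one_pos.trans hβ.1), inv_lt_one_of_one_lt₀ hβ.1]

theorem map_past_map_place (hβ : β ∈ Ioo (1 : ℝ) 2) {j n : ℤ} (h : j ≤ n) :
    ((parryInterval β).map (fun x => place n (betaDigits β x))).map (past j) =
      (parryInterval β).map (betaDigits β) := by
  have hplace : Measurable fun x => place n (betaDigits β x) :=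
    (measurable_place n).comp (measurable_betaDigits β)
  have hcomp : past j ∘ (fun x => place n (betaDigits β x)) =
      betaDigits β ∘ (betaMap β)^[(n - j).toNat] := funext fun x => past_place_betaDigits h x
  rw [Measure.map_map (measurable_past j) hplace, hcomp,
    ← Measure.map_map (measurable_betaDigits β) ((measurable_betaMap β).iterate _),
    ((measurePreserving_betaMap hβ).iterate _).map_eq]

theorem exists_probabilityMeasure_map_eq_of_eventually {X Y ι : Type*} [TopologicalSpace X]
    [T2Space X] [CompactSpace X] [MeasurableSpace X] [BorelSpace X] [HasOuterApproxClosed X]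
    [TopologicalSpace Y] [MeasurableSpace Y] [BorelSpace Y] [HasOuterApproxClosed Y]
    {g : ι → X → Y} (hg : ∀ j, Continuous (g j)) (M : ℕ → ProbabilityMeasure X)
    {D : ι → Measure Y} (hD : ∀ j, ∀ᶠ n in atTop, (M n : Measure X).map (g j) = D j)
    {C : Set X} (hC : IsClosed C) (hMC : ∀ n, (M n : Measure X) C = 1) :
    ∃ L : ProbabilityMeasure X, (∀ j, (L : Measure X).map (g j) = D j) ∧ (L : Measure X) C = 1 := by
  obtain ⟨L, -, hL⟩ := isCompact_univ.ultrafilter_le_nhds ((hyperfilter ℕ).map M) (by simp)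
  have hlim : Tendsto M (hyperfilter ℕ) (𝓝 L) := hL
  refine ⟨L, fun j => ?_, le_antisymm prob_le_one ?_⟩
  · have hmap := ((ProbabilityMeasure.continuous_map (hg j)).tendsto L).comp hlim
    obtain ⟨m, hm⟩ := (hD j).exists
    have hconst : (fun _ => (M m).map (hg j).measurable.aemeasurable) =ᶠ[hyperfilter ℕ]
        fun n => (M n).map (hg j).measurable.aemeasurable := by
      filter_upwards [Nat.hyperfilter_le_atTop (hD j)] with n hn
      exact Subtype.ext (hm.trans hn.symm)
    have heq := tendsto_nhds_unique hmap (tendsto_const_nhds.congr' hconst)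
    exact (congrArg Subtype.val heq).trans hm
  · have hlimsup := ProbabilityMeasure.limsup_measure_closed_le_of_tendsto hlim hC
    simpa only [hMC, limsup_const] using hlimsup

theorem measurableSet_betaShift (β : ℝ) : MeasurableSet (betaShift β) :=
  isClosed_closure.measurableSet

theorem measurable_betaShiftMap (β : ℝ) : Measurable (betaShiftMap β) :=
  (continuous_shift.measurable.comp measurable_subtype_coe).subtype_mk

theorem exists_measure_map_past_eq (hβ : β ∈ Ioo (1 : ℝ) 2) :
    ∃ L : ProbabilityMeasure (ℤ → Fin 2),
      (∀ j, (L : Measure (ℤ → Fin 2)).map (past j) = (parryInterval β).map (betaDigits β)) ∧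
        (L : Measure (ℤ → Fin 2)) (betaShift β) = 1 := by
  have := isProbabilityMeasure_parryInterval hβ.1
  have hplace : ∀ n : ℤ, Measurable fun x => place n (betaDigits β x) := fun n =>
    (measurable_place n).comp (measurable_betaDigits β)
  refine exists_probabilityMeasure_map_eq_of_eventually continuous_past
    (fun n : ℕ => ⟨(parryInterval β).map (fun x => place n (betaDigits β x)),
      Measure.isProbabilityMeasure_map (hplace n).aemeasurable⟩)
    (fun j => ?_) isClosed_closure fun n => ?_
  · filter_upwards [eventually_ge_atTop j.toNat] with n hn
    exact map_past_map_place hβ (by lia)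
  · rw [ProbabilityMeasure.coe_mk, Measure.map_apply (hplace n) (measurableSet_betaShift β)]
    refine (mem_ae_iff_prob_eq_one (hplace n (measurableSet_betaShift β))).1 ?_
    filter_upwards [ae_parryInterval_mem_Ico β] with x hx
    exact subset_closure (place_betaDigits_mem_preBetaShift hβ n hx)

theorem map_shift_eq_of_map_past_eq {L : Measure (ℤ → Fin 2)} [IsProbabilityMeasure L]
    (hL : ∀ j, L.map (past j) = L.map (past (j - 1))) : L.map shift = L := by
  have hmeas := continuous_shift.measurable
  have := Measure.isProbabilityMeasure_map (μ := L) hmeas.aemeasurable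
  refine ext_of_map_past fun j => ?_
  rw [Measure.map_map (measurable_past j) hmeas, hL]
  exact congrArg L.map (funext (past_shift j))

theorem exists_isParryMeasure (hβ : β ∈ Ioo (1 : ℝ) 2) :
    ∃ μ : Measure (betaShift β), IsParryMeasure β μ ∧ IsProbabilityMeasure μ := by
  obtain ⟨⟨L, hprob⟩, hpast, hsupp⟩ := exists_measure_map_past_eq hβ
  have hemb := MeasurableEmbedding.subtype_coe (measurableSet_betaShift β)
  have hmap : (L.comap Subtype.val).map (Subtype.val : betaShift β → ℤ → Fin 2) = L := by
    rw [hemb.map_comap, Subtype.range_coe]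
    exact Measure.restrict_eq_self_of_ae_mem
      ((mem_ae_iff_prob_eq_one (measurableSet_betaShift β)).2 hsupp)
  have hshift : L.map shift = L := map_shift_eq_of_map_past_eq fun j => by
    exact (hpast j).trans (hpast _).symm
  refine ⟨L.comap Subtype.val, ⟨⟨measurable_betaShiftMap β, ?_⟩, ?_⟩, ?_⟩
  · apply hemb.map_injective
    rw [Measure.map_map hemb.measurable (measurable_betaShiftMap β), hmap]
    change Measure.map (shift ∘ Subtype.val) _ = L
    rw [← Measure.map_map continuous_shift.measurable hemb.measurable, hmap, hshift]
  · have hcomp : (fun (s : betaShift β) (k : ℕ) => s.1 (-((k : ℤ) + 1))) =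
        past 0 ∘ Subtype.val := by
      funext s k
      simp [past]
    rw [hcomp, ← Measure.map_map (measurable_past 0) measurable_subtype_coe, hmap]
    exact hpast 0
  · rwa [← Measure.isProbabilityMeasure_map_iff hemb.measurable.aemeasurable, hmap]

end ParryMeasure

/-! ### Ergodicity and entropy of the Parry measure -/

section QuasiMixing

open scoped symmDiff

variable {X : Type*} [MeasurableSpace X] {μ : Measure X} [IsProbabilityMeasure μ] {T : X → X}

theorem measureReal_mul_compl_le_of_approx (hT : MeasurePreserving T μ μ) {A C D : Set X}
    (hA : MeasurableSet A) (hinv : T ⁻¹' A = A) (hC : MeasurableSet C) (hD : MeasurableSet D)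
    {ε Q : ℝ} (hε : ε ≤ 1) (hQ : 0 ≤ Q) (hAC : μ.real (A ∆ C) ≤ ε) (hAD : μ.real (Aᶜ ∆ D) ≤ ε)
    {n : ℕ} (hmix : μ.real C * μ.real D ≤ Q * μ.real (C ∩ T^[n] ⁻¹' D)) :
    μ.real A * μ.real Aᶜ ≤ ε * (2 * Q + 3) := by
  have hA_le : μ.real A ≤ μ.real C + ε := by
    linarith [(abs_le.1 (abs_measureReal_sub_le_measureReal_symmDiff (μ := μ)
      hA.nullMeasurableSet hC.nullMeasurableSet)).2]
  have hAc_le : μ.real Aᶜ ≤ μ.real D + ε := by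
    linarith [(abs_le.1 (abs_measureReal_sub_le_measureReal_symmDiff (μ := μ)
      hA.compl.nullMeasurableSet hD.nullMeasurableSet)).2]
  have hinv_iterate : T^[n] ⁻¹' Aᶜ = Aᶜ := by
    rw [preimage_compl, preimage_iterate_eq, Function.iterate_fixed hinv]
  have hsub : C ∩ T^[n] ⁻¹' D ⊆ A ∆ C ∪ T^[n] ⁻¹' (Aᶜ ∆ D) := by
    rintro x ⟨hxC, hxD⟩
    by_cases hx : x ∈ A
    · have hTx : T^[n] x ∉ Aᶜ := fun hmem => (hinv_iterate.subset hmem : x ∈ Aᶜ) hx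
      exact Or.inr (Or.inr ⟨hxD, hTx⟩)
    · exact Or.inl (Or.inr ⟨hxC, hx⟩)
  have hCD : μ.real (C ∩ T^[n] ⁻¹' D) ≤ 2 * ε := by
    have hmeas := (hA.compl.symmDiff hD).nullMeasurableSet (μ := μ)
    grw [measureReal_mono hsub, measureReal_union_le,
      (hT.iterate n).measureReal_preimage hmeas, hAC, hAD, two_mul]
  have hε0 : 0 ≤ ε := measureReal_nonneg.trans hAC
  calc μ.real A * μ.real Aᶜ ≤ (μ.real C + ε) * (μ.real D + ε) := by gcongr
    _ = μ.real C * μ.real D + ε * (μ.real C + μ.real D + ε) := by ring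
    _ ≤ Q * (2 * ε) + ε * (1 + 1 + 1) := by
        refine add_le_add (hmix.trans (mul_le_mul_of_nonneg_left hCD hQ)) ?_
        gcongr <;> exact measureReal_le_one
    _ = ε * (2 * Q + 3) := by ring

theorem ergodic_of_quasiMixing (hT : MeasurePreserving T μ μ) {𝒞 : Set (Set X)}
    (hmeas : ∀ C ∈ 𝒞, MeasurableSet C)
    (happrox : ∀ A, MeasurableSet A → T ⁻¹' A = A → ∀ ε > 0, ∃ C ∈ 𝒞, μ.real (A ∆ C) < ε)
    {Q : ℝ} (hQ : 0 ≤ Q)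
    (hmix : ∀ C ∈ 𝒞, ∀ D ∈ 𝒞, ∃ n : ℕ, μ.real C * μ.real D ≤ Q * μ.real (C ∩ T^[n] ⁻¹' D)) :
    Ergodic T μ := by
  refine ⟨hT, ⟨fun A hA hinv => ?_⟩⟩
  have hprod_le : μ.real A * μ.real Aᶜ ≤ 0 := by
    refine le_of_forall_pos_le_add fun δ hδ => ?_
    set ε := min 1 (δ / (2 * Q + 3))
    have hε : 0 < ε := by positivity
    obtain ⟨C, hC, hAC⟩ := happrox A hA hinv ε hε
    obtain ⟨D, hD, hAD⟩ := happrox Aᶜ hA.compl (by rw [preimage_compl, hinv]) ε hε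
    obtain ⟨n, hn⟩ := hmix C hC D hD
    refine (measureReal_mul_compl_le_of_approx hT hA hinv (hmeas C hC) (hmeas D hD)
      (min_le_left _ _) hQ hAC.le hAD.le hn).trans ?_
    rw [zero_add, ← le_div_iff₀ (by positivity)]
    exact min_le_right _ _
  have hprod : μ.real A * μ.real Aᶜ = 0 :=
    hprod_le.antisymm (mul_nonneg measureReal_nonneg measureReal_nonneg)
  rw [eventuallyConst_set']
  rw [mul_eq_zero, measureReal_eq_zero_iff, measureReal_eq_zero_iff] at hprod
  exact hprod.imp ae_eq_empty.2 ae_eq_univ.2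

end QuasiMixing

section ParryErgodic

open scoped symmDiff

variable {β : ℝ} {μ : Measure (betaShift β)}

theorem measurable_past_val (j : ℤ) : Measurable fun s : betaShift β => past j s.1 :=
  (measurable_past j).comp measurable_subtype_coe

theorem measurable_prefixWord_past (m : ℕ) (j : ℤ) :
    Measurable fun s : betaShift β => prefixWord m (past j s.1) :=
  (measurable_prefixWord m).comp (measurable_past_val j)

/-- The points of the β-shift for which `s_{j-1}, …, s_{j-m}` is a word in `W`. -/
def pastCylinder (β : ℝ) (j : ℤ) (m : ℕ) (W : Set (Fin m → Fin 2)) : Set (betaShift β) :=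
  {s | prefixWord m (past j s.1) ∈ W}

theorem measurableSet_pastCylinder (j : ℤ) (m : ℕ) (W : Set (Fin m → Fin 2)) :
    MeasurableSet (pastCylinder β j m W) :=
  measurable_prefixWord_past m j W.toFinite.measurableSet

theorem betaShiftMap_iterate_apply (n : ℕ) (s : betaShift β) (k : ℤ) :
    ((betaShiftMap β)^[n] s).1 k = s.1 (k - n) := by
  induction n generalizing s with
  | zero => simp
  | succ n ih =>
    rw [Function.iterate_succ_apply, ih]
    exact congrArg s.1 (by push_cast; ring)

theorem past_betaShiftMap_iterate (j : ℤ) (n : ℕ) (s : betaShift β) :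
    past j ((betaShiftMap β)^[n] s).1 = past (j - n) s.1 := by
  funext k
  rw [past, past, betaShiftMap_iterate_apply]
  exact congrArg s.1 (by ring)

theorem past_sub_apply (j : ℤ) (n k : ℕ) (s : ℤ → Fin 2) :
    past (j - n) s k = past j s (n + k) :=
  congrArg s (by push_cast; ring)

theorem preimage_iterate_pastCylinder (j : ℤ) (n m : ℕ) (W : Set (Fin m → Fin 2)) :
    (betaShiftMap β)^[n] ⁻¹' pastCylinder β j m W = pastCylinder β (j - n) m W := by
  ext s
  simp only [pastCylinder, mem_preimage, mem_ofPred_eq, past_betaShiftMap_iterate]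

theorem apply_eq_of_prefixWord_past_eq {N : ℕ} {s s' : ℤ → Fin 2}
    (h : prefixWord (2 * N) (past N s) = prefixWord (2 * N) (past N s')) {k : ℤ} (hk : -N ≤ k)
    (hk' : k < N) : s k = s' k := by
  have hpos := congrFun h ⟨(N - 1 - k).toNat, by lia⟩
  have hidx : (N : ℤ) - ((N - 1 - k).toNat + 1) = k := by lia
  simpa only [prefixWord, past, hidx] using hpos

theorem exists_preimage_val_eq_pastCylinder {t : Set (ℤ → Fin 2)}
    (ht : t ∈ measurableCylinders fun _ : ℤ => Fin 2) : ∃ N₀ : ℕ, ∀ N ≥ N₀,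
      ∃ W : Set (Fin (2 * N) → Fin 2), Subtype.val ⁻¹' t = pastCylinder β N (2 * N) W := by
  obtain ⟨N₀, hwindow⟩ := exists_window_of_mem_measurableCylinders ht
  refine ⟨N₀, fun N hN => ⟨(fun s => prefixWord (2 * N) (past N s)) '' t, ?_⟩⟩
  ext s
  refine ⟨fun hs => ⟨s.1, hs, rfl⟩, fun ⟨s', hs', heq⟩ => ?_⟩
  exact (hwindow s' s.1 fun k hk hk' =>
    apply_eq_of_prefixWord_past_eq heq (by lia) (by lia)).1 hs'

theorem exists_pastCylinder_approx [IsFiniteMeasure μ] {A : Set (betaShift β)}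
    (hA : MeasurableSet A) {ε : ℝ} (hε : 0 < ε) : ∃ N₀ : ℕ, ∀ N ≥ N₀,
      ∃ W : Set (Fin (2 * N) → Fin 2), μ.real (A ∆ pastCylinder β N (2 * N) W) < ε := by
  obtain ⟨B, hB, rfl⟩ := hA
  have hdense := Measure.MeasureDense.of_generateFrom_isSetAlgebra_finite
    (μ := μ.map Subtype.val) (isSetAlgebra_measurableCylinders (α := fun _ : ℤ => Fin 2))
    generateFrom_measurableCylinders.symm
  obtain ⟨t, ht, hlt⟩ := hdense.approx B hB (measure_ne_top _ _) ε hε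
  rw [Measure.map_apply measurable_subtype_coe (hB.symmDiff (.of_mem_measurableCylinders ht))]
    at hlt
  obtain ⟨N₀, hN₀⟩ := exists_preimage_val_eq_pastCylinder (β := β) ht
  refine ⟨N₀, fun N hN => ?_⟩
  obtain ⟨W, hW⟩ := hN₀ N hN
  refine ⟨W, ?_⟩
  rw [← hW]
  exact ENNReal.toReal_lt_of_lt_ofReal hlt

theorem exists_approx_factor {X ι κ : Type*} [MeasurableSpace X] [Fintype ι] [Nonempty ι]
    {μ : Measure X} [IsFiniteMeasure μ] {p : X → ι} {w : X → κ} {W : ι → Set κ} {ε : ℝ}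
    (h : ∀ a, μ.real ((p ⁻¹' {a}) ∆ (w ⁻¹' W a)) ≤ ε) :
    ∃ g : κ → ι, μ.real {x | p x ≠ g (w x)} ≤ Fintype.card ι * ε := by
  classical
  let g : κ → ι := fun c => if hc : ∃ a, c ∈ W a then hc.choose else Classical.arbitrary ι
  have hg : ∀ {c}, (∃ a, c ∈ W a) → c ∈ W (g c) := fun hc => by
    simpa only [g, dif_pos hc] using hc.choose_spec
  refine ⟨g, ?_⟩
  have hsub : {x | p x ≠ g (w x)} ⊆ ⋃ a, (p ⁻¹' {a}) ∆ (w ⁻¹' W a) := by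
    intro x hx
    rw [mem_iUnion]
    by_cases hc : ∃ a, w x ∈ W a
    · exact ⟨g (w x), Or.inr ⟨hg hc, hx⟩⟩
    · exact ⟨p x, Or.inl ⟨rfl, fun hmem => hc ⟨p x, hmem⟩⟩⟩
  calc μ.real {x | p x ≠ g (w x)} ≤ ∑ a, μ.real ((p ⁻¹' {a}) ∆ (w ⁻¹' W a)) :=
        (measureReal_mono hsub).trans (measureReal_iUnion_fintype_le _)
    _ ≤ ∑ _a : ι, ε := Finset.sum_le_sum fun a _ => h a
    _ = Fintype.card ι * ε := by rw [Finset.sum_const, Finset.card_univ, nsmul_eq_mul]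

theorem exists_prefixWord_past_approx {ι : Type*} [Finite ι] [MeasurableSpace ι]
    [MeasurableSingletonClass ι] [IsProbabilityMeasure μ] {p : betaShift β → ι} (hp : Measurable p)
    {δ : ℝ} (hδ : 0 < δ) : ∃ (N : ℕ) (g : (Fin (2 * N) → Fin 2) → ι),
      μ.real {s | p s ≠ g (prefixWord (2 * N) (past N s.1))} ≤ δ := by
  cases nonempty_fintype ι
  have : Nonempty ι := (nonempty_of_isProbabilityMeasure μ).map p
  choose N₀ hN₀ using fun a => exists_pastCylinder_approx (μ := μ) (hp (measurableSet_singleton a))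
    (show 0 < δ / Fintype.card ι by positivity)
  choose W hW using fun a => hN₀ a (Finset.univ.sup N₀) (Finset.le_sup (Finset.mem_univ a))
  obtain ⟨g, hg⟩ := exists_approx_factor fun a => (hW a).le
  refine ⟨_, g, hg.trans_eq ?_⟩
  field_simp

namespace IsParryMeasure

theorem measure_past_mem (h : IsParryMeasure β μ) {E : Set (ℕ → Fin 2)} (hE : MeasurableSet E) :
    μ {s | past 0 s.1 ∈ E} = parryInterval β {x | betaDigits β x ∈ E} := by
  have hpast : (fun (s : betaShift β) (k : ℕ) => s.1 (-((k : ℤ) + 1))) = fun s => past 0 s.1 := by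
    funext s k
    simp [past]
  have hmarginal := h.marginal
  rw [hpast] at hmarginal
  have hmeasure := congrArg (· E) hmarginal
  rwa [Measure.map_apply (measurable_past_val 0) hE,
    Measure.map_apply (measurable_betaDigits β) hE] at hmeasure

theorem ae_past_mem (h : IsParryMeasure β μ) {E : Set (ℕ → Fin 2)} (hE : MeasurableSet E)
    (hx : ∀ᵐ x ∂parryInterval β, betaDigits β x ∈ E) : ∀ᵐ s ∂μ, past 0 s.1 ∈ E :=
  (h.measure_past_mem hE.compl).trans hx

theorem measure_pastCylinder (h : IsParryMeasure β μ) (m : ℕ) (W : Set (Fin m → Fin 2)) :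
    μ (pastCylinder β 0 m W) = parryInterval β (digitCylinder β m W) :=
  h.measure_past_mem (measurable_prefixWord m W.toFinite.measurableSet)

theorem measure_pastCylinder_inter (h : IsParryMeasure β μ) {m m' : ℕ} (W : Set (Fin m → Fin 2))
    (W' : Set (Fin m' → Fin 2)) (n : ℕ) :
    μ (pastCylinder β 0 m W ∩ (betaShiftMap β)^[n] ⁻¹' pastCylinder β 0 m' W') =
      parryInterval β (digitCylinder β m W ∩ (betaMap β)^[n] ⁻¹' digitCylinder β m' W') := by
  have hdrop : Measurable fun (u : ℕ → Fin 2) (k : ℕ) => u (n + k) :=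
    measurable_pi_lambda _ fun k => measurable_pi_apply _
  have hmeasure := h.measure_past_mem ((measurable_prefixWord m W.toFinite.measurableSet).inter
    (hdrop (measurable_prefixWord m' W'.toFinite.measurableSet)))
  rw [preimage_iterate_pastCylinder]
  convert hmeasure using 2
  · ext s
    simp only [pastCylinder, mem_inter_iff, mem_preimage, mem_ofPred_eq, ← past_sub_apply]
  · ext x
    simp only [digitCylinder, mem_inter_iff, mem_preimage, mem_ofPred_eq, ← betaDigits_iterate]

theorem exists_pastCylinder_zero_approx [IsFiniteMeasure μ] (h : IsParryMeasure β μ)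
    {A : Set (betaShift β)} (hA : MeasurableSet A) (hinv : betaShiftMap β ⁻¹' A = A) {ε : ℝ}
    (hε : 0 < ε) : ∃ (m : ℕ) (W : Set (Fin m → Fin 2)),
      μ.real (A ∆ pastCylinder β 0 m W) < ε := by
  obtain ⟨N, hN⟩ := exists_pastCylinder_approx (μ := μ) hA hε
  obtain ⟨W, hW⟩ := hN N le_rfl
  have hmeas := hA.symmDiff (measurableSet_pastCylinder (β := β) N (2 * N) W)
  rw [← (h.invariant.iterate N).measureReal_preimage hmeas.nullMeasurableSet, preimage_symmDiff,
    preimage_iterate_pastCylinder, sub_self, preimage_iterate_eq,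
    Function.iterate_fixed hinv] at hW
  exact ⟨2 * N, W, hW⟩

theorem exists_quasiMixing [IsFiniteMeasure μ] (h : IsParryMeasure β μ)
    (hβ : β ∈ Ioo (1 : ℝ) 2) : ∃ Q : ℝ, 0 ≤ Q ∧ ∀ (m m' : ℕ) (W : Set (Fin m → Fin 2))
      (W' : Set (Fin m' → Fin 2)), ∃ n : ℕ,
      μ.real (pastCylinder β 0 m W) * μ.real (pastCylinder β 0 m' W') ≤
        Q * μ.real (pastCylinder β 0 m W ∩
          (betaShiftMap β)^[n] ⁻¹' pastCylinder β 0 m' W') := by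
  obtain ⟨Q, hQ, hmix⟩ := exists_parryInterval_digitCylinder_mul_le hβ
  refine ⟨Q.toReal, ENNReal.toReal_nonneg, fun m m' W W' => ?_⟩
  obtain ⟨n, hn⟩ := (hmix m W).exists
  refine ⟨n, ?_⟩
  have hle := hn (digitCylinder β m' W') (measurableSet_digitCylinder β m' W')
  rw [← h.measure_pastCylinder, ← h.measure_pastCylinder, ← h.measure_pastCylinder_inter] at hle
  have hreal := ENNReal.toReal_mono (ENNReal.mul_ne_top hQ (measure_ne_top _ _)) hle
  rwa [ENNReal.toReal_mul, ENNReal.toReal_mul] at hreal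

theorem ergodic [IsProbabilityMeasure μ] (h : IsParryMeasure β μ) (hβ : β ∈ Ioo (1 : ℝ) 2) :
    Ergodic (betaShiftMap β) μ := by
  obtain ⟨Q, hQ, hmix⟩ := h.exists_quasiMixing hβ
  refine ergodic_of_quasiMixing h.invariant
    (𝒞 := {C | ∃ m W, C = pastCylinder β 0 m W}) ?_ (fun A hA hinv ε hε => ?_) hQ ?_
  · rintro _ ⟨m, W, rfl⟩
    exact measurableSet_pastCylinder 0 m W
  · obtain ⟨m, W, hW⟩ := h.exists_pastCylinder_zero_approx hA hinv hε
    exact ⟨_, ⟨m, W, rfl⟩, hW⟩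
  · rintro _ ⟨m, W, rfl⟩ _ ⟨m', W', rfl⟩
    exact hmix m m' W W'

theorem partitionEntropy_prefixWord_past (h : IsParryMeasure β μ) (m N : ℕ) :
    partitionEntropy μ (fun s => prefixWord m (past N s.1)) =
      partitionEntropy μ (fun s => prefixWord m (past 0 s.1)) := by
  rw [← partitionEntropy_comp_measurePreserving (h.invariant.iterate N)
    (measurable_prefixWord_past m N)]
  simp only [Function.comp_def, past_betaShiftMap_iterate, sub_self]

theorem ae_prefixWord_past_mem_orbitWords (h : IsParryMeasure β μ) (hβ0 : 0 ≤ β) (hβ2 : β < 2)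
    (m : ℕ) : ∀ᵐ s ∂μ, prefixWord m (past 0 s.1) ∈ orbitWords β m 1 := by
  refine h.ae_past_mem (measurable_prefixWord m (orbitWords β m 1).toFinite.measurableSet) ?_
  filter_upwards [ae_parryInterval_mem_Ico β] with x hx
  exact prefixWord_betaDigits_mem_orbitWords hβ0 hβ2 m (Ico_subset_Icc_self hx)

theorem exists_partitionEntropy_prefixWord_past_le [IsProbabilityMeasure μ]
    (h : IsParryMeasure β μ) (hβ : β ∈ Ioo (1 : ℝ) 2) : ∃ C : ℝ, ∀ m N : ℕ,
      partitionEntropy μ (fun s => prefixWord m (past N s.1)) ≤ m * Real.log β + C := by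
  classical
  have hβ0 : 0 < β := one_pos.trans hβ.1
  obtain ⟨C, hC, hcard⟩ := exists_ncard_orbitWords_le hβ
  refine ⟨Real.log C, fun m N => ?_⟩
  have hae := h.ae_prefixWord_past_mem_orbitWords hβ0.le hβ.2 m
  have hpos : (0 : ℝ) < (orbitWords β m 1).ncard := by
    obtain ⟨s, hs⟩ := hae.exists
    exact_mod_cast (ncard_pos (toFinite _)).2 ⟨_, hs⟩
  have hle := partitionEntropy_le_log_card (measurable_prefixWord_past m 0)
    (orbitWords β m 1).toFinset (by simpa only [mem_toFinset] using hae)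
  rw [← ncard_eq_toFinset_card'] at hle
  rw [h.partitionEntropy_prefixWord_past]
  refine (hle.trans (Real.log_le_log hpos (hcard m))).trans_eq ?_
  rw [Real.log_mul hC.ne' (by positivity), Real.log_pow, add_comm]

theorem metricEntropyWrt_le_log [IsProbabilityMeasure μ] (h : IsParryMeasure β μ)
    (hβ : β ∈ Ioo (1 : ℝ) 2) {ι : Type*} [Fintype ι] [MeasurableSpace ι]
    [MeasurableSingletonClass ι] {p : betaShift β → ι} (hp : Measurable p) :
    metricEntropyWrt (betaShiftMap β) μ p ≤ Real.log β := by
  obtain ⟨C, hC⟩ := h.exists_partitionEntropy_prefixWord_past_le hβ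
  refine metricEntropyWrt_le_of_approx h.invariant hp fun δ hδ => ?_
  obtain ⟨N, g, hg⟩ := exists_prefixWord_past_approx (μ := μ) hp hδ
  refine ⟨fun s => g (prefixWord (2 * N) (past N s.1)), 2 * N * Real.log β + C,
    (measurable_of_finite g).comp (measurable_prefixWord_past _ _), hg, fun n => ?_⟩
  have hitinerary : itinerary (betaShiftMap β) (fun s => g (prefixWord (2 * N) (past N s.1))) n =
      (fun (w : Fin (2 * N + n) → Fin 2) (i : Fin (n + 1)) =>
        g fun j : Fin (2 * N) => w ⟨i + j, by lia⟩) ∘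
      fun s => prefixWord (2 * N + n) (past N s.1) := by
    funext s i
    simp only [itinerary, Function.comp_apply, past_betaShiftMap_iterate]
    exact congrArg g (funext fun j => past_sub_apply _ _ _ _)
  rw [hitinerary]
  refine (partitionEntropy_comp_le (measurable_prefixWord_past _ _) _).trans
    ((hC _ _).trans_eq ?_)
  push_cast
  ring

theorem measureReal_pastCylinder_le (h : IsParryMeasure β μ) (hβ : β ∈ Ioo (1 : ℝ) 2) {m : ℕ}
    (w : Fin m → Fin 2) :
    μ.real (pastCylinder β 0 m {w}) ≤ (parryBound β).toReal * β⁻¹ ^ m := by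
  have hβ0 : 0 < β := one_pos.trans hβ.1
  have hle := parryInterval_digitCylinder_le hβ0 hβ.2 w
  rw [← h.measure_pastCylinder] at hle
  have hreal := ENNReal.toReal_mono (ENNReal.mul_ne_top (parryBound_ne_top hβ.1)
    (ENNReal.pow_ne_top ENNReal.ofReal_ne_top)) hle
  rwa [ENNReal.toReal_mul, ENNReal.toReal_pow, ENNReal.toReal_ofReal (inv_nonneg.2 hβ0.le)]
    at hreal

theorem log_le_metricEntropyWrt [IsProbabilityMeasure μ] (h : IsParryMeasure β μ)
    (hβ : β ∈ Ioo (1 : ℝ) 2) :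
    (Real.log β : EReal) ≤ metricEntropyWrt (betaShiftMap β) μ (fun s => s.1 (-1)) := by
  have hβ0 : 0 < β := one_pos.trans hβ.1
  have hbound : 0 < (parryBound β).toReal := by
    refine ENNReal.toReal_pos (fun hzero => ?_) (parryBound_ne_top hβ.1)
    simpa using ENNReal.tsum_eq_zero.1 hzero 0
  refine le_limsup_div (C := Real.log β - Real.log (parryBound β).toReal) fun n => ?_
  have hitinerary : itinerary (betaShiftMap β) (fun s : betaShift β => s.1 (-1)) n =
      fun s => prefixWord (n + 1) (past 0 s.1) := by
    funext s i
    simp only [itinerary, prefixWord, past, betaShiftMap_iterate_apply]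
    exact congrArg s.1 (by ring)
  rw [hitinerary]
  refine le_trans (le_of_eq ?_) (neg_log_le_partitionEntropy (measurable_prefixWord_past (n + 1) 0)
    fun w => h.measureReal_pastCylinder_le hβ w)
  rw [Real.log_mul hbound.ne' (by positivity), Real.log_pow, Real.log_inv]
  push_cast
  ring

theorem metricEntropy_eq [IsProbabilityMeasure μ] (h : IsParryMeasure β μ)
    (hβ : β ∈ Ioo (1 : ℝ) 2) : metricEntropy (betaShiftMap β) μ = Real.log β := by
  refine le_antisymm (iSup_le fun k => iSup_le fun p => iSup_le fun hp =>
    h.metricEntropyWrt_le_log hβ hp) ?_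
  have hmeas : Measurable fun s : betaShift β => s.1 (-1) :=
    (measurable_pi_apply _).comp measurable_subtype_coe
  exact (h.log_le_metricEntropyWrt hβ).trans (metricEntropyWrt_le_metricEntropy hmeas)

end IsParryMeasure

end ParryErgodic

/-! ### The attractor -/

section Attractor

variable {β τ : ℝ}

/-- The unit square `[0,1]²`. -/
def unitSquare : Set (ℝ × ℝ) := Icc (0 : ℝ) 1 ×ˢ Icc (0 : ℝ) 1

/-- The intersection `⋂ fⁱ([0,1]²)`, whose closure is the attractor. -/
def attractorCore (β τ : ℝ) : Set (ℝ × ℝ) := ⋂ i : ℕ, (bakerMap β τ)^[i] '' unitSquare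

/-- The index of the branch of `f` applied at `p`: `0` for `x ≤ β⁻¹` and `1` for `x > β⁻¹`. -/
def bakerDigit (β : ℝ) (p : ℝ × ℝ) : Fin 2 := if p.1 ≤ β⁻¹ then 0 else 1

theorem bakerMap_eq (β τ : ℝ) (p : ℝ × ℝ) : bakerMap β τ p =
    (β * p.1 - ((bakerDigit β p : ℕ) : ℝ), τ * p.2 + ((bakerDigit β p : ℕ) : ℝ) * (1 - τ)) := by
  unfold bakerMap bakerDigit
  split_ifs <;> simp

theorem bakerMap_mem_unitSquare (hβ0 : 0 < β) (hβ2 : β ≤ 2) (hτ : τ ∈ Icc (0 : ℝ) 1) {p : ℝ × ℝ}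
    (hp : p ∈ unitSquare) : bakerMap β τ p ∈ unitSquare := by
  obtain ⟨⟨hx0, hx1⟩, hy0, hy1⟩ := hp
  obtain ⟨hτ0, hτ1⟩ := hτ
  unfold bakerMap
  split_ifs with hp
  · have hle : β * p.1 ≤ 1 := by rwa [← le_inv_mul_iff₀ hβ0, mul_one]
    exact ⟨⟨by positivity, hle⟩, by positivity, mul_le_one₀ hτ1 hy0 hy1⟩
  · have hlt : 1 < β * p.1 := by rwa [← inv_mul_lt_iff₀ hβ0, mul_one, ← not_le]
    refine ⟨⟨?_, ?_⟩, ?_, ?_⟩ <;> dsimp only <;> nlinarith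

theorem attractorCore_subset_unitSquare : attractorCore β τ ⊆ unitSquare :=
  (iInter_subset _ 0).trans (image_id _).subset

theorem attractor_subset_unitSquare : attractor β τ ⊆ unitSquare :=
  closure_minimal attractorCore_subset_unitSquare (isClosed_Icc.prod isClosed_Icc)

theorem isCompact_attractor : IsCompact (attractor β τ) :=
  (isCompact_Icc.prod isCompact_Icc).of_isClosed_subset isClosed_closure attractor_subset_unitSquare

theorem bakerMap_mem_attractorCore (hβ0 : 0 < β) (hβ2 : β ≤ 2) (hτ : τ ∈ Icc (0 : ℝ) 1)
    {p : ℝ × ℝ} (hp : p ∈ attractorCore β τ) : bakerMap β τ p ∈ attractorCore β τ := by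
  refine mem_iInter.2 fun i => ?_
  cases i with
  | zero => simpa using bakerMap_mem_unitSquare hβ0 hβ2 hτ (attractorCore_subset_unitSquare hp)
  | succ i =>
    obtain ⟨q, hq, rfl⟩ := mem_iInter.1 hp i
    exact ⟨q, hq, Function.iterate_succ_apply' _ _ _⟩

theorem exists_bakerMap_eq_of_le (hβ0 : 0 < β) (τ : ℝ) (p : ℝ × ℝ) {x : ℝ} (hx0 : 0 < x)
    (hx : x ≤ (bakerMap β τ p).1) :
    ∃ u, 0 < u ∧ u ≤ p.1 ∧ bakerMap β τ (u, p.2) = (x, (bakerMap β τ p).2) := by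
  unfold bakerMap at hx ⊢
  split_ifs at hx ⊢ with hp
  · have hle : x / β ≤ p.1 := by rwa [div_le_iff₀' hβ0]
    exact ⟨x / β, by positivity, hle, by rw [if_pos (hle.trans hp), mul_div_cancel₀ _ hβ0.ne']⟩
  · have hlt : ¬(x + 1) / β ≤ β⁻¹ := by
      rw [not_le, lt_div_iff₀ hβ0, inv_mul_cancel₀ hβ0.ne']
      linarith
    refine ⟨(x + 1) / β, by positivity, ?_, ?_⟩
    · rw [div_le_iff₀' hβ0]
      exact le_sub_iff_add_le.1 hx
    · rw [if_neg hlt, mul_div_cancel₀ _ hβ0.ne', add_sub_cancel_right]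

theorem mem_image_iterate_of_le (hβ0 : 0 < β) (i : ℕ) {x x' y : ℝ}
    (h : (x, y) ∈ (bakerMap β τ)^[i] '' unitSquare) (hx0 : 0 < x') (hx : x' ≤ x) :
    (x', y) ∈ (bakerMap β τ)^[i] '' unitSquare := by
  induction i generalizing x x' y with
  | zero =>
    rw [Function.iterate_zero, image_id] at h ⊢
    exact ⟨⟨hx0.le, hx.trans h.1.2⟩, h.2⟩
  | succ i ih =>
    simp only [Function.iterate_succ', image_comp] at h ih ⊢
    obtain ⟨p, hp, hpxy⟩ := h
    obtain ⟨u, hu0, hu, hux⟩ := exists_bakerMap_eq_of_le hβ0 τ p hx0 (by rwa [hpxy])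
    exact ⟨(u, p.2), ih hp hu0 hu, by rw [hux, hpxy]⟩

theorem continuousAt_bakerMap {p : ℝ × ℝ} (hp : β⁻¹ < p.1) : ContinuousAt (bakerMap β τ) p := by
  have hright : (fun q : ℝ × ℝ => (β * q.1 - 1, τ * q.2 + (1 - τ))) =ᶠ[𝓝 p] bakerMap β τ := by
    filter_upwards [continuous_fst.continuousAt.eventually (lt_mem_nhds hp)] with q hq
    rw [bakerMap, if_neg hq.not_ge]
  exact ContinuousAt.congr (by fun_prop) hright

/- At a point `p` with `p.1 = β⁻¹`, `f` is continuous only from the left. Clipping the abscissa at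
`β⁻¹` makes the left branch continuous everywhere, and it still maps the core to itself, because the
horizontal fibres of the core are downward closed. -/
theorem mapsTo_attractor (hβ0 : 0 < β) (hβ2 : β ≤ 2) (hτ : τ ∈ Icc (0 : ℝ) 1) :
    MapsTo (bakerMap β τ) (attractor β τ) (attractor β τ) := by
  intro p hp
  rcases le_or_gt p.1 β⁻¹ with hle | hlt
  · let clipped : ℝ × ℝ → ℝ × ℝ := fun q => (β * min q.1 β⁻¹, τ * q.2)
    have hmaps : MapsTo clipped (attractorCore β τ) (attractorCore β τ) := by
      intro q hq
      have hclip : (min q.1 β⁻¹, q.2) ∈ attractorCore β τ := by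
        rcases le_total q.1 β⁻¹ with hle | hle
        · rwa [min_eq_left hle]
        · rw [min_eq_right hle]
          exact mem_iInter.2 fun i =>
            mem_image_iterate_of_le hβ0 i (mem_iInter.1 hq i) (by positivity) hle
      have hmem := bakerMap_mem_attractorCore hβ0 hβ2 hτ hclip
      rwa [bakerMap, if_pos (min_le_right _ _)] at hmem
    have hmem : clipped p ∈ attractor β τ := hmaps.closure (by fun_prop) hp
    rwa [bakerMap, if_pos hle, ← min_eq_left hle]
  · refine closure_mono ?_ (mem_closure_image (continuousAt_bakerMap hlt) hp)
    rintro _ ⟨q, hq, rfl⟩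
    exact bakerMap_mem_attractorCore hβ0 hβ2 hτ hq

theorem segment_mem_attractor (hβ1 : 1 ≤ β) (τ : ℝ) {x : ℝ} (hx : x ∈ Icc (0 : ℝ) 1) :
    (x, (0 : ℝ)) ∈ attractor β τ := by
  have hβ0 : 0 < β := one_pos.trans_le hβ1
  refine subset_closure (mem_iInter.2 fun i => ?_)
  induction i generalizing x with
  | zero => exact ⟨(x, 0), ⟨hx, by simp⟩, rfl⟩
  | succ i ih =>
    have hle : x / β ≤ β⁻¹ := by rw [div_le_iff₀ hβ0, inv_mul_cancel₀ hβ0.ne']; exact hx.2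
    rw [Function.iterate_succ', image_comp]
    refine ⟨(x / β, 0), ih ⟨div_nonneg hx.1 hβ0.le, hle.trans (inv_le_one_of_one_le₀ hβ1)⟩, ?_⟩
    rw [bakerMap, if_pos hle, mul_div_cancel₀ _ hβ0.ne', mul_zero]

theorem bakerMap_iterate_sub {p q : ℝ × ℝ} (m : ℕ) (h : ∀ j < m,
      bakerDigit β ((bakerMap β τ)^[j] p) = bakerDigit β ((bakerMap β τ)^[j] q)) :
    (bakerMap β τ)^[m] p - (bakerMap β τ)^[m] q =
      (β ^ m * (p.1 - q.1), τ ^ m * (p.2 - q.2)) := by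
  induction m with
  | zero => simp [Prod.ext_iff]
  | succ m ih =>
    have hsub := ih fun j hj => h j (by omega)
    rw [Function.iterate_succ_apply', Function.iterate_succ_apply', bakerMap_eq,
      bakerMap_eq β τ ((bakerMap β τ)^[m] q), h m (by omega)]
    rw [Prod.ext_iff] at hsub ⊢
    simp only [Prod.fst_sub, Prod.snd_sub] at hsub ⊢
    exact ⟨by linear_combination β * hsub.1, by linear_combination τ * hsub.2⟩

theorem abs_fst_sub_le_of_bakerDigit_eq (hβ0 : 0 < β) {p q : ℝ × ℝ} {m : ℕ}
    (hp : (bakerMap β τ)^[m] p ∈ unitSquare) (hq : (bakerMap β τ)^[m] q ∈ unitSquare)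
    (h : ∀ j < m, bakerDigit β ((bakerMap β τ)^[j] p) = bakerDigit β ((bakerMap β τ)^[j] q)) :
    |p.1 - q.1| ≤ β⁻¹ ^ m := by
  have hsub := congrArg Prod.fst (bakerMap_iterate_sub m h)
  have hle := abs_sub_le_of_le_of_le hp.1.1 hp.1.2 hq.1.1 hq.1.2
  rw [← Prod.fst_sub, hsub, abs_mul, abs_of_pos (by positivity), sub_zero] at hle
  rwa [inv_pow, ← one_div, le_div_iff₀' (by positivity)]

theorem dist_iterate_lt_of_bakerDigit_eq (hβ0 : 0 < β) (hτ : τ ∈ Icc (0 : ℝ) 1) {p q : ℝ × ℝ}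
    {i m : ℕ} {δ : ℝ} (hp : (bakerMap β τ)^[i + m] p ∈ unitSquare)
    (hq : (bakerMap β τ)^[i + m] q ∈ unitSquare)
    (h : ∀ j < i + m, bakerDigit β ((bakerMap β τ)^[j] p) = bakerDigit β ((bakerMap β τ)^[j] q))
    (hm : β⁻¹ ^ m < δ) (hpq : |p.2 - q.2| < δ) :
    dist ((bakerMap β τ)^[i] p) ((bakerMap β τ)^[i] q) < δ := by
  rw [Prod.dist_eq, max_lt_iff, Real.dist_eq, Real.dist_eq]
  constructor
  · refine (abs_fst_sub_le_of_bakerDigit_eq (τ := τ) hβ0 ?_ ?_ fun j hj => ?_).trans_lt hm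
    · rwa [← Function.iterate_add_apply, add_comm]
    · rwa [← Function.iterate_add_apply, add_comm]
    · simpa only [← Function.iterate_add_apply] using h (j + i) (by omega)
  · have hsub := congrArg Prod.snd (bakerMap_iterate_sub i fun j hj => h j (by omega))
    rw [← Prod.snd_sub, hsub, abs_mul, abs_of_nonneg (pow_nonneg hτ.1 _)]
    exact (mul_le_of_le_one_left (abs_nonneg _) (pow_le_one₀ hτ.1 hτ.2)).trans_lt hpq

/- Close points on different sides of the discontinuity have images whose abscissas are near `1` and
`0`, respectively. -/
theorem bakerDigit_eq_of_dist_lt (hβ0 : 0 < β) (hβ2 : β < 2) {p q : ℝ × ℝ}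
    (hpq : dist p q < 1 / 3) (himage : dist (bakerMap β τ p) (bakerMap β τ q) < 1 / 3) :
    bakerDigit β p = bakerDigit β q := by
  have hsub : |p.1 - q.1| < 1 / 3 := (le_max_left _ _).trans_lt hpq
  have hsub_image := (le_max_left _ _).trans_lt himage
  rw [bakerMap_eq, bakerMap_eq β τ q, Real.dist_eq] at hsub_image
  have hdigit : |((bakerDigit β p : ℕ) : ℝ) - (bakerDigit β q : ℕ)| < 1 := by
    rw [abs_lt] at hsub hsub_image ⊢
    constructor <;> nlinarith
  have hdigit_int : |((bakerDigit β p : ℕ) : ℤ) - (bakerDigit β q : ℕ)| < 1 := by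
    exact_mod_cast hdigit
  rw [Int.abs_lt_one_iff, sub_eq_zero] at hdigit_int
  exact Fin.ext (by exact_mod_cast hdigit_int)

end Attractor

/-! ### Topological entropy of the attractor -/

section Cover

variable {X : Type*} {V : Set (Set X)}

theorem exists_subcover_of_labelling {α : Type*} {ℓ : X → α} {G : Set α} (hG : G.Finite)
    (hℓ : ∀ x, ℓ x ∈ G) (hV : ∀ x₀, ∃ W ∈ V, ∀ x, ℓ x = ℓ x₀ → x ∈ W) :
    ∃ F : Finset (Set X), (F : Set (Set X)) ⊆ V ∧ ⋃₀ (F : Set (Set X)) = univ ∧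
      F.card ≤ G.ncard := by
  choose W hWV hW using hV
  have hrange : range ℓ ⊆ G := range_subset_iff.2 hℓ
  have : Finite (range ℓ) := hG.subset hrange
  have hfin := finite_range fun a : range ℓ => W (rangeSplitting ℓ a)
  refine ⟨hfin.toFinset, ?_, ?_, ?_⟩
  · rw [hfin.coe_toFinset]
    exact range_subset_iff.2 fun a => hWV _
  · refine eq_univ_of_forall fun x => ⟨W (rangeSplitting ℓ ⟨ℓ x, x, rfl⟩), ?_, hW _ _ ?_⟩
    · rw [hfin.coe_toFinset]
      exact mem_range_self _
    · exact (apply_rangeSplitting ℓ ⟨ℓ x, x, rfl⟩).symm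
  · rw [← ncard_eq_toFinset_card _ hfin]
    exact (Finite.card_range_le _).trans (ncard_le_ncard hrange hG)

theorem exists_card_eq_coverNumber (h : ∃ F : Finset (Set X), (F : Set (Set X)) ⊆ V ∧
    ⋃₀ (F : Set (Set X)) = univ) :
    ∃ F : Finset (Set X), (F : Set (Set X)) ⊆ V ∧ ⋃₀ (F : Set (Set X)) = univ ∧
      F.card = coverNumber V :=
  let ⟨F, hF, hFc⟩ := h
  Nat.sInf_mem (s := {n : ℕ | ∃ F : Finset (Set X), (F : Set (Set X)) ⊆ V ∧
    ⋃₀ (F : Set (Set X)) = univ ∧ F.card = n}) ⟨_, F, hF, hFc, rfl⟩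

theorem coverNumber_le_card {F : Finset (Set X)} (hF : (F : Set (Set X)) ⊆ V)
    (hFc : ⋃₀ (F : Set (Set X)) = univ) : coverNumber V ≤ F.card :=
  Nat.sInf_le ⟨F, hF, hFc, rfl⟩

theorem coverNumber_pos [Nonempty X] (h : ∃ F : Finset (Set X), (F : Set (Set X)) ⊆ V ∧
    ⋃₀ (F : Set (Set X)) = univ) : 0 < coverNumber V := by
  obtain ⟨F, -, hFc, hcard⟩ := exists_card_eq_coverNumber h
  obtain ⟨W, hW, -⟩ := hFc.symm ▸ mem_univ (Classical.arbitrary X)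
  exact hcard ▸ Finset.card_pos.2 ⟨W, hW⟩

theorem one_le_card_mul_of_Icc_subset {ι : Type*} {F : Finset ι} {S : ι → Set ℝ} {r : ℝ}
    (hcov : Icc (0 : ℝ) 1 ⊆ ⋃ a ∈ F, S a) (hr : 0 ≤ r)
    (hS : ∀ a ∈ F, ∀ x ∈ S a, ∀ y ∈ S a, |x - y| ≤ r) : 1 ≤ F.card * r := by
  have hvol : ∀ a ∈ F, volume (S a) ≤ ENNReal.ofReal r := fun a ha =>
    (Real.volume_le_diam _).trans (Metric.ediam_le fun x hx y hy => by
      rw [edist_dist, Real.dist_eq]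
      exact ENNReal.ofReal_le_ofReal (hS a ha x hx y hy))
  rw [← ENNReal.ofReal_le_ofReal_iff (by positivity)]
  calc ENNReal.ofReal 1 = volume (Icc (0 : ℝ) 1) := by simp
    _ ≤ volume (⋃ a ∈ F, S a) := measure_mono hcov
    _ ≤ ∑ a ∈ F, volume (S a) := measure_biUnion_finset_le _ _
    _ ≤ ∑ _a ∈ F, ENNReal.ofReal r := Finset.sum_le_sum hvol
    _ = ENNReal.ofReal (F.card * r) := by
      rw [Finset.sum_const, ENNReal.ofReal_mul (by positivity), ENNReal.ofReal_natCast,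
        nsmul_eq_mul]

end Cover

section TopologicalEntropy

variable {β τ : ℝ}

theorem bakerDigit_word_mem_orbitWords (hf : MapsTo (bakerMap β τ) (attractor β τ) (attractor β τ))
    {p : ℝ × ℝ} (hp : p ∈ attractor β τ) (n : ℕ) :
    (fun i : Fin n => bakerDigit β ((bakerMap β τ)^[i] p)) ∈ orbitWords β n 1 := by
  have hmem : ∀ i, (bakerMap β τ)^[i] p ∈ unitSquare := fun i =>
    attractor_subset_unitSquare (hf.iterate i hp)
  refine ⟨fun i => ((bakerMap β τ)^[i] p).1, (hmem 0).1.2, fun i _ => (hmem i).1, fun i => ?_⟩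
  beta_reduce
  rw [Function.iterate_succ_apply', bakerMap_eq]

theorem abs_sub_lt_of_floor_mul_eq {M x y : ℝ} (hM : 0 < M) (h : ⌊M * x⌋ = ⌊M * y⌋) :
    |x - y| < M⁻¹ := by
  have hlt := Int.abs_sub_lt_one_of_floor_eq_floor h
  rwa [← mul_sub, abs_mul, abs_of_pos hM, ← lt_inv_mul_iff₀ hM, mul_one] at hlt

/- A point is determined up to a small error, together with `n` of its images, by its first `n + m`
branch digits and by its ordinate up to a small error: expansion of the abscissa by `β ^ m` controls
the horizontal error, while vertical errors never grow. -/
theorem exists_subcover_coverJoin (hβ : β ∈ Ioo (1 : ℝ) 2) (hτ : τ ∈ Icc (0 : ℝ) 1)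
    (hf : MapsTo (bakerMap β τ) (attractor β τ) (attractor β τ)) {U : Set (Set (attractor β τ))}
    (hU : ∀ u ∈ U, IsOpen u) (hUc : ⋃₀ U = univ) :
    ∃ C : ℝ, 0 < C ∧ ∀ n, ∃ F : Finset (Set (attractor β τ)),
      (F : Set (Set (attractor β τ))) ⊆ coverJoin (hf.restrict _ _ _) U n ∧
      ⋃₀ (F : Set (Set (attractor β τ))) = univ ∧ (F.card : ℝ) ≤ C * β ^ n := by
  have hβ0 : 0 < β := one_pos.trans hβ.1
  have : CompactSpace (attractor β τ) := isCompact_iff_compactSpace.1 isCompact_attractor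
  obtain ⟨δ, hδ, hball⟩ := lebesgue_number_lemma_of_metric_sUnion isCompact_univ hU hUc.ge
  obtain ⟨m, hm⟩ := exists_pow_lt_of_lt_one hδ (inv_lt_one_of_one_lt₀ hβ.1)
  obtain ⟨M, hM⟩ := exists_nat_gt δ⁻¹
  have hM0 : (0 : ℝ) < M := (inv_pos.2 hδ).trans hM
  obtain ⟨C, hC, hcount⟩ := exists_ncard_orbitWords_le hβ
  have hmem : ∀ (p : attractor β τ) i, (bakerMap β τ)^[i] p ∈ unitSquare := fun p i =>
    attractor_subset_unitSquare (hf.iterate i p.2)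
  refine ⟨C * β ^ m * (M + 1), by positivity, fun n => ?_⟩
  have hlabel : ∀ p : attractor β τ,
      ((fun i : Fin (n + m) => bakerDigit β ((bakerMap β τ)^[i] p)), ⌊M * p.1.2⌋) ∈
        orbitWords β (n + m) 1 ×ˢ Icc (0 : ℤ) M := fun p =>
    have hle : M * p.1.2 ≤ M := mul_le_of_le_one_right hM0.le (hmem p 0).2.2
    ⟨bakerDigit_word_mem_orbitWords hf p.2 _, Int.floor_nonneg.2 (mul_nonneg hM0.le (hmem p 0).2.1),
      Int.floor_le_iff.2 (by exact_mod_cast hle.trans_lt (lt_add_one _))⟩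
  obtain ⟨F, hF, hFc, hcard⟩ := exists_subcover_of_labelling
    (V := coverJoin (hf.restrict _ _ _) U n) (toFinite _) hlabel (by
      intro p₀
      choose c hcU hc using fun i : Fin (n + 1) =>
        hball ((hf.restrict _ _ _)^[(i : ℕ)] p₀) (mem_univ _)
      refine ⟨_, ⟨c, hcU, rfl⟩, fun p hp => mem_iInter.2 fun i => hc i ?_⟩
      obtain ⟨hword, hfloor⟩ := Prod.mk.inj hp
      rw [Metric.mem_ball, hf.iterate_restrict]
      exact dist_iterate_lt_of_bakerDigit_eq hβ0 hτ (hmem p _) (hmem p₀ _)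
        (fun j hj => congrFun hword ⟨j, by omega⟩) hm
        ((abs_sub_lt_of_floor_mul_eq hM0 hfloor).trans (inv_lt_of_inv_lt₀ hδ hM)))
  refine ⟨F, hF, hFc, ?_⟩
  calc (F.card : ℝ) ≤ (orbitWords β (n + m) 1).ncard * (M + 1) := by
        rw [ncard_prod, ← Finset.coe_Icc, ncard_coe_finset] at hcard
        exact_mod_cast hcard.trans_eq (by simp)
    _ ≤ C * β ^ (n + m) * (M + 1) := by grw [hcount]
    _ = C * β ^ m * (M + 1) * β ^ n := by ring

theorem coverEntropyWrt_le_log (hβ : β ∈ Ioo (1 : ℝ) 2) (hτ : τ ∈ Icc (0 : ℝ) 1)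
    (hf : MapsTo (bakerMap β τ) (attractor β τ) (attractor β τ)) {U : Set (Set (attractor β τ))}
    (hU : ∀ u ∈ U, IsOpen u) (hUc : ⋃₀ U = univ) :
    coverEntropyWrt (hf.restrict _ _ _) U ≤ Real.log β := by
  have hβ0 : 0 < β := one_pos.trans hβ.1
  have : Nonempty (attractor β τ) := ⟨⟨_, segment_mem_attractor hβ.1.le τ ⟨le_rfl, zero_le_one⟩⟩⟩
  obtain ⟨C, hC, hsubcover⟩ := exists_subcover_coverJoin hβ hτ hf hU hUc
  refine limsup_div_le (C := Real.log C) fun n => ?_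
  obtain ⟨F, hF, hFc, hcard⟩ := hsubcover n
  have hpos := coverNumber_pos ⟨F, hF, hFc⟩
  calc Real.log (coverNumber (coverJoin (hf.restrict _ _ _) U n)) ≤ Real.log (C * β ^ n) := by
        refine Real.log_le_log (by exact_mod_cast hpos) (le_trans ?_ hcard)
        exact_mod_cast coverNumber_le_card hF hFc
    _ = n * Real.log β + Real.log C := by
        rw [Real.log_mul hC.ne' (by positivity), Real.log_pow, add_comm]

/- The cells of a separating cover cut the bottom edge of the square, a segment of length one in the
expanded direction, into pieces of length at most `β⁻¹ ^ n`. -/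
theorem pow_le_card_of_separating_cover (hβ : β ∈ Ioo (1 : ℝ) 2)
    (hf : MapsTo (bakerMap β τ) (attractor β τ) (attractor β τ)) {n : ℕ}
    {F : Finset (Set (attractor β τ))} (hFc : ⋃₀ (F : Set (Set (attractor β τ))) = univ)
    (hF : ∀ W ∈ F, ∀ p ∈ W, ∀ q ∈ W, ∀ i ≤ n,
      dist ((bakerMap β τ)^[i] p) ((bakerMap β τ)^[i] q) < 1 / 3) : β ^ n ≤ F.card := by
  have hβ0 : 0 < β := one_pos.trans hβ.1
  have hcov : Icc (0 : ℝ) 1 ⊆ ⋃ W ∈ F, {x | (x, 0) ∈ Subtype.val '' W} := by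
    intro x hx
    obtain ⟨W, hW, hxW⟩ := hFc.symm ▸
      mem_univ (⟨(x, 0), segment_mem_attractor hβ.1.le τ hx⟩ : attractor β τ)
    exact mem_biUnion hW ⟨_, hxW, rfl⟩
  have hcard : 1 ≤ F.card * β⁻¹ ^ n := by
    refine one_le_card_mul_of_Icc_subset hcov (by positivity) ?_
    rintro W hW x ⟨p, hp, hpx⟩ y ⟨q, hq, hqy⟩
    have hle : |p.1.1 - q.1.1| ≤ β⁻¹ ^ n := abs_fst_sub_le_of_bakerDigit_eq hβ0
      (attractor_subset_unitSquare (hf.iterate n p.2))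
      (attractor_subset_unitSquare (hf.iterate n q.2)) fun j hj =>
        bakerDigit_eq_of_dist_lt hβ0 hβ.2 (hF W hW p hp q hq j hj.le) (by
          simpa only [Function.iterate_succ_apply'] using hF W hW p hp q hq (j + 1) hj)
    rwa [hpx, hqy] at hle
  rwa [inv_pow, ← div_eq_mul_inv, le_div_iff₀ (by positivity), one_mul] at hcard

theorem topologicalEntropy_eq (hβ : β ∈ Ioo (1 : ℝ) 2) (hτ : τ ∈ Icc (0 : ℝ) 1)
    (hf : MapsTo (bakerMap β τ) (attractor β τ) (attractor β τ)) :
    topologicalEntropy (hf.restrict _ _ _) = Real.log β := by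
  have hβ0 : 0 < β := one_pos.trans hβ.1
  refine le_antisymm (iSup₂_le fun U hU => coverEntropyWrt_le_log hβ hτ hf hU.1 hU.2) ?_
  let U : Set (Set (attractor β τ)) := range fun p => Metric.ball p (1 / 6)
  have hopen : ∀ u ∈ U, IsOpen u := forall_mem_range.2 fun p => Metric.isOpen_ball
  have hcov : ⋃₀ U = univ :=
    eq_univ_of_forall fun p => ⟨_, mem_range_self p, Metric.mem_ball_self (by norm_num)⟩
  refine le_iSup₂_of_le U ⟨hopen, hcov⟩ (le_limsup_div (C := 0) fun n => ?_)
  obtain ⟨C, -, hsubcover⟩ := exists_subcover_coverJoin hβ hτ hf hopen hcov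
  obtain ⟨F₀, hF₀, hF₀c, -⟩ := hsubcover n
  obtain ⟨F, hF, hFc, hcard⟩ := exists_card_eq_coverNumber ⟨F₀, hF₀, hF₀c⟩
  have hpow : β ^ n ≤ F.card := by
    refine pow_le_card_of_separating_cover hβ hf hFc fun W hW p hp q hq i hi => ?_
    obtain ⟨c, hc, rfl⟩ := hF hW
    obtain ⟨r, hr⟩ := hc ⟨i, by omega⟩
    have hp_mem := mem_iInter.1 hp ⟨i, by omega⟩
    have hq_mem := mem_iInter.1 hq ⟨i, by omega⟩
    rw [← hr, hf.iterate_restrict] at hp_mem hq_mem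
    exact (dist_triangle_right _ _ r.1).trans_lt ((add_lt_add hp_mem hq_mem).trans_eq (by norm_num))
  rw [add_zero, ← Real.log_pow, ← hcard]
  exact Real.log_le_log (by positivity) hpow

end TopologicalEntropy

/-! ### The coding map as a factor map -/

section Factor

variable {X Y : Type*} [MeasurableSpace X] [MeasurableSpace Y] {μ : Measure X} {ν : Measure Y}
  {T : X → X} {S : Y → Y} {g : X → Y}

theorem measurePreserving_of_ae_semiconj (hT : MeasurePreserving T μ μ) (hS : Measurable S)
    (hg : MeasurePreserving g μ ν) (h : ∀ᵐ x ∂μ, g (T x) = S (g x)) :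
    MeasurePreserving S ν ν := by
  refine ⟨hS, ?_⟩
  calc ν.map S = μ.map (S ∘ g) := by rw [← hg.map_eq, Measure.map_map hS hg.measurable]
    _ = μ.map (g ∘ T) := Measure.map_congr (h.mono fun _ => Eq.symm)
    _ = ν := by rw [← Measure.map_map hg.measurable hT.measurable, hT.map_eq, hg.map_eq]

theorem ergodic_of_ae_semiconj (hT : Ergodic T μ) (hS : Measurable S)
    (hg : MeasurePreserving g μ ν) (h : ∀ᵐ x ∂μ, g (T x) = S (g x)) : Ergodic S ν := by
  refine ⟨measurePreserving_of_ae_semiconj hT.toMeasurePreserving hS hg h, ⟨fun A hA hinv => ?_⟩⟩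
  rw [← hg.aeconst_preimage hA.nullMeasurableSet]
  refine hT.quasiErgodic.aeconst_set₀ (hg.measurable hA).nullMeasurableSet ?_
  filter_upwards [h] with x hx
  have hmem : g (T x) ∈ A ↔ g x ∈ A := by rw [hx, ← mem_preimage, hinv]
  exact propext hmem

theorem ae_iterate_semiconj {Z : Type*} {g : X → Z} {S : Z → Z} (hT : MeasurePreserving T μ μ)
    (h : ∀ᵐ x ∂μ, g (T x) = S (g x)) (n : ℕ) : ∀ᵐ x ∂μ, g (T^[n] x) = S^[n] (g x) := by
  induction n with
  | zero => exact Eventually.of_forall fun _ => rfl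
  | succ n ih =>
    filter_upwards [ih, (hT.iterate n).quasiMeasurePreserving.ae h] with x hx hxn
    rw [Function.iterate_succ_apply', Function.iterate_succ_apply', hxn, hx]

theorem itinerary_congr_ae {ι : Type*} (hT : MeasurePreserving T μ μ) {p q : X → ι}
    (h : p =ᵐ[μ] q) (n : ℕ) : itinerary T p n =ᵐ[μ] itinerary T q n := by
  filter_upwards [ae_all_iff.2 fun i => (hT.iterate i).quasiMeasurePreserving.ae h] with x hx
  exact funext fun i => hx i

theorem metricEntropyWrt_congr_ae {ι : Type*} [Fintype ι] (hT : MeasurePreserving T μ μ)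
    {p q : X → ι} (h : p =ᵐ[μ] q) : metricEntropyWrt T μ p = metricEntropyWrt T μ q := by
  simp only [metricEntropyWrt, fun n => partitionEntropy_congr (itinerary_congr_ae hT h n)]

theorem metricEntropyWrt_of_ae_semiconj {ι : Type*} [Fintype ι] [MeasurableSpace ι]
    [MeasurableSingletonClass ι] (hT : MeasurePreserving T μ μ) (hS : Measurable S)
    (hg : MeasurePreserving g μ ν) (h : ∀ᵐ x ∂μ, g (T x) = S (g x)) {p : Y → ι}
    (hp : Measurable p) : metricEntropyWrt S ν p = metricEntropyWrt T μ (p ∘ g) := by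
  have hitinerary : ∀ n, itinerary S p n ∘ g =ᵐ[μ] itinerary T (p ∘ g) n := fun n => by
    filter_upwards [ae_all_iff.2 fun i => ae_iterate_semiconj hT h i] with x hx
    exact funext fun i => congrArg p (hx i).symm
  have hentropy : ∀ n, partitionEntropy ν (itinerary S p n) =
      partitionEntropy μ (itinerary T (p ∘ g) n) := fun n => by
    rw [← partitionEntropy_comp_measurePreserving hg (measurable_itinerary hS hp n),
      partitionEntropy_congr (hitinerary n)]
  simp only [metricEntropyWrt, hentropy]

theorem metricEntropy_le_of_ae_semiconj (hT : MeasurePreserving T μ μ) (hS : Measurable S)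
    (hg : MeasurePreserving g μ ν) (h : ∀ᵐ x ∂μ, g (T x) = S (g x)) :
    metricEntropy S ν ≤ metricEntropy T μ :=
  iSup_le fun _ => iSup₂_le fun _ hp => by
    rw [metricEntropyWrt_of_ae_semiconj hT hS hg h hp]
    exact metricEntropyWrt_le_metricEntropy (hp.comp hg.measurable)

end Factor

section Coding

variable {β τ : ℝ}

/-- The coding `π(σ⁻ⁿ s)` of the sequence `s` recentred at position `n`. -/
def codingAt (β τ : ℝ) (n : ℤ) (s : ℤ → Fin 2) : ℝ × ℝ :=
  (β⁻¹ * digitSeries β⁻¹ (past n s), (1 - τ) * digitSeries τ fun k => s (n + k))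

theorem coding_eq_codingAt_zero (β τ : ℝ) : coding β τ = codingAt β τ 0 := by
  refine funext fun s => Prod.ext ?_ ?_
  · rw [codingAt, ← tsum_digit_mul_pow_succ]
    simp only [coding, past, zero_sub]
  · simp only [coding, codingAt, digitSeries, zero_add, ← tsum_mul_left, mul_assoc, mul_left_comm]

theorem codingAt_shift (β τ : ℝ) (n : ℤ) (s : ℤ → Fin 2) :
    codingAt β τ n (shift s) = codingAt β τ (n - 1) s := by
  simp only [codingAt, past_shift, shift, add_sub_right_comm]

theorem measurable_codingAt (hβ : 1 < β) (hτ : |τ| < 1) (n : ℤ) : Measurable (codingAt β τ n) := by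
  have hfst := (continuous_digitSeries (abs_inv_lt_one hβ)).measurable.comp (measurable_past n)
  have hsnd : Measurable fun s : ℤ → Fin 2 => digitSeries τ fun k => s (n + k) :=
    (continuous_digitSeries hτ).measurable.comp
      (measurable_pi_lambda _ fun k => measurable_pi_apply _)
  exact (hfst.const_mul _).prodMk (hsnd.const_mul _)

theorem measurable_coding (hβ : 1 < β) (hτ : |τ| < 1) : Measurable (coding β τ) :=
  coding_eq_codingAt_zero β τ ▸ measurable_codingAt hβ hτ 0

theorem codingAt_snd_mem_Icc (β : ℝ) (hτ : τ ∈ Ico (0 : ℝ) 1) (n : ℤ) (s : ℤ → Fin 2) :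
    (codingAt β τ n s).2 ∈ Icc (0 : ℝ) 1 := by
  have hpos : 0 < 1 - τ := sub_pos.2 hτ.2
  refine ⟨mul_nonneg hpos.le (digitSeries_nonneg hτ.1 _), ?_⟩
  rw [codingAt, ← le_inv_mul_iff₀ hpos, mul_one]
  exact digitSeries_le hτ.1 hτ.2 _

theorem bakerMap_codingAt_succ (hβ : 1 < β) (hτ : |τ| < 1) {n : ℤ} {s : ℤ → Fin 2}
    (h : bakerDigit β (codingAt β τ (n + 1) s) = s n) :
    bakerMap β τ (codingAt β τ (n + 1) s) = codingAt β τ n s := by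
  have hβ0 : β ≠ 0 := (one_pos.trans hβ).ne'
  have hpast := digitSeries_eq_head_add (abs_inv_lt_one hβ) (past (n + 1) s)
  have hfuture := digitSeries_eq_head_add hτ fun k => s (n + k)
  simp only [past_succ_zero, past_succ_succ] at hpast
  simp only [Nat.cast_zero, add_zero, Nat.cast_succ, ← add_assoc, add_right_comm n _ 1] at hfuture
  rw [bakerMap_eq, h, codingAt, codingAt, hpast, hfuture, mul_inv_cancel_left₀ hβ0]
  exact Prod.ext (by ring) (by ring)

theorem mem_attractor_of_backward_orbit {x : ℕ → ℝ × ℝ} (hx : ∀ n, x n ∈ unitSquare)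
    (hstep : ∀ n, bakerMap β τ (x (n + 1)) = x n) : x 0 ∈ attractor β τ := by
  have hiterate : ∀ n, (bakerMap β τ)^[n] (x n) = x 0 := fun n => by
    induction n with
    | zero => rfl
    | succ n ih => rw [Function.iterate_succ_apply, hstep, ih]
  exact subset_closure (mem_iInter.2 fun n => ⟨x n, hx n, hiterate n⟩)

theorem measurable_bakerMap (β τ : ℝ) : Measurable (bakerMap β τ) := by
  refine Measurable.ite (measurableSet_le measurable_fst measurable_const) ?_ ?_ <;> fun_prop

theorem measurable_bakerDigit (β : ℝ) : Measurable (bakerDigit β) :=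
  Measurable.ite (measurableSet_le measurable_fst measurable_const) measurable_const
    measurable_const

theorem betaDigits_zero_eq_bakerDigit (hβ0 : 0 < β) {p : ℝ × ℝ} (hp : p.1 ≠ β⁻¹) :
    betaDigits β p.1 0 = bakerDigit β p := by
  rw [bakerDigit]
  split_ifs with hle
  · rw [betaDigits_zero_eq_zero, ← lt_inv_mul_iff₀ hβ0, mul_one]
    exact hle.lt_of_ne hp
  · rw [betaDigits_zero_eq_one, ← inv_mul_le_iff₀ hβ0, mul_one]
    exact (not_le.1 hle).le

namespace IsParryMeasure

variable {μ : Measure (betaShift β)}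

theorem ae_past_natCast_mem (h : IsParryMeasure β μ) {E : Set (ℕ → Fin 2)} (hE : MeasurableSet E)
    (hx : ∀ᵐ x ∂parryInterval β, betaDigits β x ∈ E) (n : ℕ) : ∀ᵐ s ∂μ, past n s.1 ∈ E := by
  have hT := h.invariant.iterate n
  rw [← hT.map_eq, ae_map_iff hT.aemeasurable (measurable_past_val n hE)]
  simpa only [past_betaShiftMap_iterate, sub_self] using h.ae_past_mem hE hx

/- The branch of `f` applied at `π(s)` agrees with the digit `s_{-1}` except when the abscissa of
`π(s)` is the discontinuity `β⁻¹`, where `f` takes the left branch but the greedy digit is `1`. -/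
theorem ae_codingAt (h : IsParryMeasure β μ) (hβ : β ∈ Ioo (1 : ℝ) 2) (hτ : τ ∈ Ico (0 : ℝ) 1)
    (n : ℕ) : ∀ᵐ s ∂μ, codingAt β τ n s.1 ∈ unitSquare ∧
      bakerDigit β (codingAt β τ n s.1) = past n s.1 0 := by
  let value : (ℕ → Fin 2) → ℝ := fun u => β⁻¹ * digitSeries β⁻¹ u
  have hvalue : Measurable value :=
    (continuous_digitSeries (abs_inv_lt_one hβ.1)).measurable.const_mul _
  let E : Set (ℕ → Fin 2) := {u | value u ∈ Icc (0 : ℝ) 1 ∧ bakerDigit β (value u, 0) = u 0}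
  have hE : MeasurableSet E := (hvalue measurableSet_Icc).inter (measurableSet_eq_fun
    ((measurable_bakerDigit β).comp (hvalue.prodMk measurable_const)) (measurable_pi_apply 0))
  have hne : ∀ᵐ x ∂parryInterval β, x ≠ β⁻¹ :=
    (parryInterval_absolutelyContinuous β).ae_le (volume.ae_ne _)
  have hdigits : ∀ᵐ x ∂parryInterval β, betaDigits β x ∈ E := by
    filter_upwards [ae_parryInterval_mem_Ico β, hne] with x hx hx_ne
    have hx_Icc := Ico_subset_Icc_self hx
    have hx_value : value (betaDigits β x) = x := inv_mul_digitSeries_betaDigits hβ hx_Icc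
    rw [mem_ofPred_eq, hx_value]
    exact ⟨hx_Icc, (betaDigits_zero_eq_bakerDigit (p := (x, 0)) (one_pos.trans hβ.1) hx_ne).symm⟩
  filter_upwards [h.ae_past_natCast_mem hE hdigits n] with s hs
  exact ⟨⟨hs.1, codingAt_snd_mem_Icc β hτ n s.1⟩, hs.2⟩

theorem ae_coding_mem_attractor (h : IsParryMeasure β μ) (hβ : β ∈ Ioo (1 : ℝ) 2)
    (hτ : τ ∈ Ico (0 : ℝ) 1) : ∀ᵐ s ∂μ, coding β τ s.1 ∈ attractor β τ := by
  filter_upwards [ae_all_iff.2 fun n => h.ae_codingAt hβ hτ n] with s hs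
  rw [coding_eq_codingAt_zero]
  refine mem_attractor_of_backward_orbit (x := fun n => codingAt β τ n s.1) (fun n => (hs n).1)
    fun n => ?_
  have hdigit := (hs (n + 1)).2
  rw [Nat.cast_succ, past_succ_zero] at hdigit
  rw [Nat.cast_succ]
  exact bakerMap_codingAt_succ hβ.1 ((abs_of_nonneg hτ.1).trans_lt hτ.2) hdigit

theorem ae_bakerDigit_coding (h : IsParryMeasure β μ) (hβ : β ∈ Ioo (1 : ℝ) 2)
    (hτ : τ ∈ Ico (0 : ℝ) 1) : ∀ᵐ s ∂μ, bakerDigit β (coding β τ s.1) = s.1 (-1) := by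
  filter_upwards [h.ae_codingAt hβ hτ 0] with s hs
  rw [coding_eq_codingAt_zero]
  exact hs.2

theorem ae_coding_betaShiftMap (h : IsParryMeasure β μ) (hβ : β ∈ Ioo (1 : ℝ) 2)
    (hτ : τ ∈ Ico (0 : ℝ) 1) :
    ∀ᵐ s ∂μ, coding β τ (betaShiftMap β s).1 = bakerMap β τ (coding β τ s.1) := by
  filter_upwards [h.ae_bakerDigit_coding hβ hτ] with s hs
  have hbaker := bakerMap_codingAt_succ (τ := τ) (n := -1) (s := s.1) hβ.1
    ((abs_of_nonneg hτ.1).trans_lt hτ.2)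
  rw [neg_add_cancel, ← coding_eq_codingAt_zero, ← zero_sub 1, ← codingAt_shift,
    ← coding_eq_codingAt_zero] at hbaker
  exact (hbaker hs).symm

theorem exists_attractor_valued_coding (h : IsParryMeasure β μ) (hβ : β ∈ Ioo (1 : ℝ) 2)
    (hτ : τ ∈ Ico (0 : ℝ) 1) : ∃ g : betaShift β → attractor β τ, Measurable g ∧
      ∀ᵐ s ∂μ, (g s : ℝ × ℝ) = coding β τ s.1 := by
  have hmeas : Measurable fun s : betaShift β => coding β τ s.1 :=
    (measurable_coding hβ.1 ((abs_of_nonneg hτ.1).trans_lt hτ.2)).comp measurable_subtype_coe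
  obtain ⟨g, hg, hrange, hae⟩ := hmeas.aemeasurable.exists_ae_eq_range_subset
    (h.ae_coding_mem_attractor hβ hτ) ⟨_, segment_mem_attractor hβ.1.le τ ⟨le_rfl, zero_le_one⟩⟩
  exact ⟨fun s => ⟨g s, hrange (mem_range_self s)⟩, hg.subtype_mk, hae.mono fun _ => Eq.symm⟩

variable {g : betaShift β → attractor β τ}

theorem ae_semiconj_of_ae_eq_coding (h : IsParryMeasure β μ) (hβ : β ∈ Ioo (1 : ℝ) 2)
    (hτ : τ ∈ Ico (0 : ℝ) 1) (hf : MapsTo (bakerMap β τ) (attractor β τ) (attractor β τ))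
    (hg : ∀ᵐ s ∂μ, (g s : ℝ × ℝ) = coding β τ s.1) :
    ∀ᵐ s ∂μ, g (betaShiftMap β s) = hf.restrict _ _ _ (g s) := by
  filter_upwards [hg, h.invariant.quasiMeasurePreserving.ae hg, h.ae_coding_betaShiftMap hβ hτ]
    with s hs hs_shift hs_coding
  exact Subtype.ext (by rw [hs_shift, hs_coding, hf.val_restrict_apply, hs])

theorem log_le_metricEntropy_of_ae_eq_coding [IsProbabilityMeasure μ] (h : IsParryMeasure β μ)
    (hβ : β ∈ Ioo (1 : ℝ) 2) (hτ : τ ∈ Ico (0 : ℝ) 1)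
    {ν : Measure (attractor β τ)} {S : attractor β τ → attractor β τ} (hS : Measurable S)
    (hμν : MeasurePreserving g μ ν) (hg : ∀ᵐ s ∂μ, (g s : ℝ × ℝ) = coding β τ s.1)
    (hsemiconj : ∀ᵐ s ∂μ, g (betaShiftMap β s) = S (g s)) :
    (Real.log β : EReal) ≤ metricEntropy S ν := by
  have hmeas : Measurable fun p : attractor β τ => bakerDigit β p :=
    (measurable_bakerDigit β).comp measurable_subtype_coe
  have hdigit : (fun p : attractor β τ => bakerDigit β p) ∘ g =ᵐ[μ] fun s => s.1 (-1) := by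
    filter_upwards [hg, h.ae_bakerDigit_coding hβ hτ] with s hs hs_digit
    rw [Function.comp_apply, hs, hs_digit]
  calc (Real.log β : EReal) ≤ metricEntropyWrt (betaShiftMap β) μ fun s => s.1 (-1) :=
        h.log_le_metricEntropyWrt hβ
    _ = metricEntropyWrt S ν fun p => bakerDigit β p := by
        rw [metricEntropyWrt_of_ae_semiconj h.invariant hS hμν hsemiconj hmeas,
          metricEntropyWrt_congr_ae h.invariant hdigit]
    _ ≤ metricEntropy S ν := metricEntropyWrt_le_metricEntropy hmeas

end IsParryMeasure

end Coding

end

end BetaAttractor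

open BetaAttractor in
theorem mainTheorem2_general (β τ : ℝ) (hβ : β ∈ Ioo (1 : ℝ) 2) (hτ : τ ∈ Ico (0 : ℝ) 1) :
    ∃ hf : MapsTo (bakerMap β τ) (attractor β τ) (attractor β τ),
      topologicalEntropy (hf.restrict _ _ _) = (Real.log β : EReal) ∧
      ∃ (μ : Measure (betaShift β)) (ν : Measure (attractor β τ)),
        IsParryMeasure β μ ∧ IsProbabilityMeasure μ ∧ Ergodic (betaShiftMap β) μ ∧
        metricEntropy (betaShiftMap β) μ = (Real.log β : EReal) ∧
        ν.map Subtype.val = μ.map (fun s => coding β τ s.1) ∧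
        IsProbabilityMeasure ν ∧ Ergodic (hf.restrict _ _ _) ν ∧
        metricEntropy (hf.restrict _ _ _) ν = (Real.log β : EReal) := by
  have hf := mapsTo_attractor (one_pos.trans hβ.1) hβ.2.le (Ico_subset_Icc_self hτ)
  have hf_meas : Measurable (hf.restrict (bakerMap β τ) (attractor β τ) (attractor β τ)) :=
    ((measurable_bakerMap β τ).comp measurable_subtype_coe).subtype_mk
  obtain ⟨μ, hμ, hprob⟩ := exists_isParryMeasure hβ
  obtain ⟨g, hg_meas, hg⟩ := hμ.exists_attractor_valued_coding hβ hτ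
  have hgμ : MeasurePreserving g μ (μ.map g) := ⟨hg_meas, rfl⟩
  have hsemiconj := hμ.ae_semiconj_of_ae_eq_coding hβ hτ hf hg
  refine ⟨hf, topologicalEntropy_eq hβ (Ico_subset_Icc_self hτ) hf, μ, μ.map g, hμ, hprob,
    hμ.ergodic hβ, hμ.metricEntropy_eq hβ, ?_,
    Measure.isProbabilityMeasure_map hg_meas.aemeasurable,
    ergodic_of_ae_semiconj (hμ.ergodic hβ) hf_meas hgμ hsemiconj, le_antisymm ?_
    (hμ.log_le_metricEntropy_of_ae_eq_coding hβ hτ hf_meas hgμ hg hsemiconj)⟩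
  · rw [Measure.map_map measurable_subtype_coe hg_meas]
    exact Measure.map_congr hg
  · rw [← hμ.metricEntropy_eq hβ]
    exact metricEntropy_le_of_ae_semiconj hμ.invariant hf_meas hgμ hsemiconj

theorem mainTheorem2 (β τ : ℝ) (hβ : β ∈ Set.Ioo (1 : ℝ) 2) (hτ : τ ∈ Set.Ioo (0 : ℝ) (1 / 2)) :
    ∃ hf : Set.MapsTo (BetaAttractor.bakerMap β τ) (BetaAttractor.attractor β τ)
        (BetaAttractor.attractor β τ),
      BetaAttractor.topologicalEntropy (hf.restrict _ _ _) = ((Real.log β : ℝ) : EReal) ∧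
      ∃ (μ : MeasureTheory.Measure (BetaAttractor.betaShift β))
        (ν : MeasureTheory.Measure (BetaAttractor.attractor β τ)),
        BetaAttractor.IsParryMeasure β μ ∧
        MeasureTheory.IsProbabilityMeasure μ ∧
        Ergodic (BetaAttractor.betaShiftMap β) μ ∧
        BetaAttractor.metricEntropy (BetaAttractor.betaShiftMap β) μ =
          ((Real.log β : ℝ) : EReal) ∧
        -- `ν` is the image of `μ` under the coding map
        ν.map Subtype.val = μ.map (fun s => BetaAttractor.coding β τ s.1) ∧
        MeasureTheory.IsProbabilityMeasure ν ∧
        Ergodic (hf.restrict _ _ _) ν ∧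
        BetaAttractor.metricEntropy (hf.restrict _ _ _) ν = ((Real.log β : ℝ) : EReal) :=
  mainTheorem2_general β τ hβ ⟨hτ.1.le, hτ.2.trans (by norm_num)⟩
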